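/- **Setting.** Fix $d\in\mathbb N$. Let $\mathcal P_2(\mathbb R^d\times\mathbb R^d)$ be the set of Borel probability measures on $\mathbb R^d\times\mathbb R^d$ with finite second moment. For $p\in\{1,2\}$ let ${\bf d}_p(\mu,\nu)=\inf_\gamma\big(\int|z-z'|^p\,d\gamma(z,z')\big)^{1/p}$, the infimum being over all couplings $\gamma$ of $\mu$ and $\nu$; $\mathcal P_2$ carries the topology of ${\bf d}_2$. Let $L:\mathbb R^d\times\mathbb R^d\times\mathcal P_2(\mathbb R^d\times\mathbb R^d)\to\mathbb R$, $(x,a,\mu)\mapsto L(x,a,\mu)$, and $$H(x,p,\mu)=\sup_{a\in\mathbb R^d}\{-a\cdot p-L(x,a,\mu)\}.$$ For a function $f$ on $\mathcal P_2$, $D_\mu f(\mu,\cdot)$ denotes its Wasserstein (Lions) derivative. A flat derivative of $f$ at $\mu$ is a continuous function $\frac{\delta}{\delta m}f(\mu,\cdot)$ with $\lim_{t\downarrow0}\frac1t\big(f(\mu+t(\nu-\mu))-f(\mu)\big)=\int\frac{\delta}{\delta m}f(\mu,y)\,d(\nu-\mu)(y)$ for all $\nu\in\mathcal P_2$. **Regularity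 assumption.** * $L$ is fully $C^2$: with $z=(x,a)$, the derivatives $D_zL$, $D_\mu L(z,\mu,y)$, $D_{zz}L$, $D_\mu D_zL$, $D_zD_\mu L$, $D_yD_\mu L$, $D_{\mu}D_\mu L$ exist everywhere and, like $L$, are jointly continuous in all their arguments. All second derivatives and $D_\mu L$ are uniformly bounded. * There is $c>0$ with $D_{aa}L(x,a,\mu)\ge c\,I_{d\times d}$ for all $(x,a,\mu)$. * There is $C>0$ such that for all $(x,a,\mu)$ $$\tfrac1C|a|^2-C\big(1+|x|^2+{\bf d}_2(\mu,\delta_0)\big)\le L(x,a,\mu)\le C|a|^2+C\big(1+|x|^2+{\bf d}_2(\mu,\delta_0)\big).$$ * $D_xL$ and $D_aL$ have flat derivatives $\frac{\delta}{\delta m}D_xL(x,a,\mu,x',a')$ and $\frac{\delta}{\delta m}D_aL(x,a,\mu,x',a')$ that are uniformly Lipschitz in $(x,a,\mu,x',a')$, with respect to ${\bf d}_1$ in $\mu$. **Weak displacement monotonicity.** There are constants $C_{L,a}>0$, $C_{L,x}\ge0$ such that for all square-integrable $\mathbb R^d$-valued random vectors $X,\overline X,\alpha,\overline\alpha$ (on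 a common probability space), with $\mathcal L$ denoting the law, $$\mathbb E\Big[\big(D_aL(X,\alpha,\mathcal L(X,\alpha))-D_aL(\overline X,\overline\alpha,\mathcal L(\overline X,\overline\alpha))\big)\cdot(\alpha-\overline\alpha)+\big(D_xL(X,\alpha,\mathcal L(X,\alpha))-D_xL(\overline X,\overline\alpha,\mathcal L(\overline X,\overline\alpha))\big)\cdot(X-\overline X)\Big]\ \ge\ C_{L,a}\,\mathbb E|\alpha-\overline\alpha|^2-C_{L,x}\,\mathbb E|X-\overline X|^2 .$$ **Proposition.** Let both assumptions hold. Then: 1. For every $\nu\in\mathcal P_2(\mathbb R^d\times\mathbb R^d)$ the equation $$\mu=\Big((x,p)\mapsto\big(x,-D_pH(x,p,\mu)\big)\Big)_{\#}\nu$$ has exactly one solution $\mu=\Phi(\nu)\in\mathcal P_2(\mathbb R^d\times\mathbb R^d)$, and there is a constant $C$ with ${\bf d}_2(\Phi(\nu_1),\Phi(\nu_2))\le C\,{\bf d}_2(\nu_1,\nu_2)$ for all $\nu_1,\nu_2$. 2. There are a constant $C$ and $N_0\ge2$ such that the following holds for every $N\ge N_0$. For $\boldsymbol x,\boldsymbol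 a\in(\mathbb R^d)^N$ write $m^N_{\boldsymbol x,\boldsymbol a}=\frac1N\sum_{j=1}^N\delta_{(x^j,a^j)}$ and $m^{N,-i}_{\boldsymbol x,\boldsymbol a}=\frac1{N-1}\sum_{j\ne i}\delta_{(x^j,a^j)}$. For all $\boldsymbol x,\boldsymbol p\in(\mathbb R^d)^N$ the system $$a^i=-D_pH\big(x^i,p^i,m^{N,-i}_{\boldsymbol x,\boldsymbol a}\big),\qquad i=1,\dots,N,$$ has exactly one solution $\boldsymbol a=\boldsymbol a^N(\boldsymbol x,\boldsymbol p)\in(\mathbb R^d)^N$. For all $\boldsymbol x,\boldsymbol p,\overline{\boldsymbol x},\overline{\boldsymbol p}\in(\mathbb R^d)^N$, $$\sum_{i=1}^N|a^{N,i}(\boldsymbol x,\boldsymbol p)-a^{N,i}(\overline{\boldsymbol x},\overline{\boldsymbol p})|^2\le C\sum_{i=1}^N\big(|x^i-\overline x^i|^2+|p^i-\overline p^i|^2\big),$$ $${\bf d}_2^2\Big(\Phi(m^N_{\boldsymbol x,\boldsymbol p}),\,m^N_{\boldsymbol x,\boldsymbol a^N(\boldsymbol x,\boldsymbol p)}\Big)\le\frac{C}{N^2}\sum_{i=1}^N\big(|x^i|^2+|p^i|^2\big).$$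 -/

import Mathlib

open MeasureTheory Filter Topology
open scoped ENNReal unitInterval

noncomputable section

namespace MFGC

/-! ### The space of probability measures with finite second moment -/

section Measures

variable {W : Type*} [NormedAddCommGroup W] [MeasurableSpace W]

/-- Borel probability measures on `W` with finite second moment. -/
def P2 (W : Type*) [NormedAddCommGroup W] [MeasurableSpace W] : Type _ :=
  {μ : Measure W // IsProbabilityMeasure μ ∧ ∫⁻ x, ‖x‖ₑ ^ 2 ∂μ < ∞}

/-- The measure underlying an element of `P2 W`. -/
def P2.toMeasure (μ : P2 W) : Measure W := μ.1

/-- The couplings of two measures: measures on the product with the given marginals. -/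
def couplings (μ ν : Measure W) : Set (Measure (W × W)) :=
  {γ | γ.map Prod.fst = μ ∧ γ.map Prod.snd = ν}

/-- The Monge--Kantorovich--Wasserstein distance of order `p` (used for `p = 1, 2`). -/
def wasserstein (p : ℝ) (μ ν : P2 W) : ℝ :=
  ((⨅ γ ∈ couplings μ.toMeasure ν.toMeasure, ∫⁻ z, ‖z.1 - z.2‖ₑ ^ p ∂γ) ^ (1 / p)).toReal

/-- The distance `d₁`. -/
def d1 (μ ν : P2 W) : ℝ := wasserstein 1 μ ν

/-- The distance `d₂`. -/
def d2 (μ ν : P2 W) : ℝ := wasserstein 2 μ ν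

/-- `P2 W` carries the topology of the distance `d₂`: a set is open if and only if it
contains, with each of its points, a `d₂`-ball around that point. -/
instance : TopologicalSpace (P2 W) where
  IsOpen U := ∀ μ ∈ U, ∃ r > 0, ∀ ν, d2 μ ν < r → ν ∈ U
  isOpen_univ := fun _ _ => ⟨1, one_pos, fun _ _ => trivial⟩
  isOpen_inter := by
    rintro U V hU hV μ ⟨h1, h2⟩
    obtain ⟨r, hr, h⟩ := hU μ h1
    obtain ⟨s, hs, h'⟩ := hV μ h2
    exact ⟨min r s, lt_min hr hs, fun ν hν =>
      ⟨h ν (lt_of_lt_of_le hν (min_le_left _ _)), h' ν (lt_of_lt_of_le hν (min_le_right _ _))⟩⟩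
  isOpen_sUnion := by
    rintro S hS μ ⟨U, hU, hμ⟩
    obtain ⟨r, hr, h⟩ := hS U hU μ hμ
    exact ⟨r, hr, fun ν hν => ⟨U, hU, h ν hν⟩⟩

/-- The Dirac mass at `x`. -/
def P2.dirac [MeasurableSingletonClass W] (x : W) : P2 W :=
  ⟨Measure.dirac x, inferInstance, by simp [lintegral_dirac]⟩

/-- The convex combination `(1 - t) μ + t ν`. -/
def P2.mix (t : I) (μ ν : P2 W) : P2 W :=
  ⟨ENNReal.ofReal (1 - t) • μ.toMeasure + ENNReal.ofReal t • ν.toMeasure, by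
    obtain ⟨⟨h1⟩, h2⟩ := μ.2
    obtain ⟨⟨h1'⟩, h2'⟩ := ν.2
    refine ⟨⟨?_⟩, ?_⟩
    · simp only [P2.toMeasure, Measure.add_apply, Measure.smul_apply, h1, h1', smul_eq_mul,
        mul_one]
      rw [← ENNReal.ofReal_add (by linarith [t.2.2]) t.2.1]
      simp
    · simp only [P2.toMeasure, lintegral_add_measure, lintegral_smul_measure, smul_eq_mul]
      exact ENNReal.add_lt_top.2 ⟨ENNReal.mul_lt_top ENNReal.ofReal_lt_top h2,
        ENNReal.mul_lt_top ENNReal.ofReal_lt_top h2'⟩⟩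

/-- The empirical measure `(1 / #s) ∑_{j ∈ s} δ_{z j}` of the points `z j`, `j ∈ s`. For the
empty set `s`, where there is no such measure, the value is a Dirac mass by convention. -/
def P2.empirical [MeasurableSingletonClass W] {ι : Type*} (s : Finset ι) (z : ι → W) : P2 W :=
  open Classical in
  if hs : s.Nonempty then
    ⟨(s.card : ℝ≥0∞)⁻¹ • ∑ j ∈ s, Measure.dirac (z j), by
      have h0 : (s.card : ℝ≥0∞) ≠ 0 := by simpa using hs.ne_empty
      refine ⟨⟨?_⟩, ?_⟩
      · simp [ENNReal.inv_mul_cancel h0 (ENNReal.natCast_ne_top _)]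
      · rw [lintegral_smul_measure, lintegral_finsetSum_measure]
        refine ENNReal.mul_lt_top (ENNReal.inv_lt_top.2 (pos_iff_ne_zero.2 h0)) ?_
        refine ENNReal.sum_lt_top.2 fun j _ => ?_
        rw [lintegral_dirac]
        simp⟩
  else P2.dirac 0

/-- The law of a square-integrable random variable. -/
def P2.law [BorelSpace W] {Ω : Type*} [MeasurableSpace Ω] (P : Measure Ω) [IsProbabilityMeasure P]
    (Z : Ω → W) (hZ : MemLp Z 2 P) : P2 W :=
  ⟨P.map Z, Measure.isProbabilityMeasure_map hZ.aestronglyMeasurable.aemeasurable, by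
    have h := hZ.eLpNorm_lt_top
    rw [eLpNorm_lt_top_iff_lintegral_rpow_enorm_lt_top (by norm_num) (by norm_num)] at h
    rw [lintegral_map' (by fun_prop) hZ.aestronglyMeasurable.aemeasurable]
    simpa using h⟩

end Measures

/-! ### Differential calculus on the space of measures -/

section Calculus

variable {V W F : Type*} [NormedAddCommGroup V] [NormedSpace ℝ V]
  [NormedAddCommGroup W] [NormedSpace ℝ W] [MeasurableSpace W]
  [NormedAddCommGroup F] [NormedSpace ℝ F]

/-- `u` is differentiable at `μ` in the sense of Wasserstein (equivalently, in the sense of Lions),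
with derivative `ξ = D_μ u(μ, ·)`. For square-integrable random variables `X ∼ μ` and `Y`, with
joint law `γ`, one has `u(law Y) = u(μ) + E[ξ(X)(Y - X)] + o(‖Y - X‖_{L²})`; that is, the lift of
`u` to the `L²` space of random variables is Fréchet differentiable at `X`, with derivative
`ξ(X)`. -/
def HasLDeriv (u : P2 W → F) (ξ : W → W →L[ℝ] F) (μ : P2 W) : Prop :=
  MemLp ξ 2 μ.toMeasure ∧
  ∀ ε > 0, ∃ δ > 0, ∀ ν : P2 W, ∀ γ ∈ couplings μ.toMeasure ν.toMeasure,
    √(∫ z, ‖z.2 - z.1‖ ^ 2 ∂γ) ≤ δ →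
      ‖u ν - u μ - ∫ z, ξ z.1 (z.2 - z.1) ∂γ‖ ≤ ε * √(∫ z, ‖z.2 - z.1‖ ^ 2 ∂γ)

/-- The continuous function `g` is a flat derivative (first variation) of `f` at `μ`: for all `ν`,
`(f(μ + t (ν - μ)) - f(μ)) / t → ∫ g d(ν - μ)` as `t ↓ 0`. -/
def HasFlatDeriv (f : P2 W → F) (g : W → F) (μ : P2 W) : Prop :=
  Continuous g ∧ (∀ ν : P2 W, Integrable g ν.toMeasure) ∧
  ∀ ν : P2 W, Tendsto (fun t : I => (t : ℝ)⁻¹ • (f (P2.mix t μ ν) - f μ)) (𝓝[>] 0)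
    (𝓝 (∫ y, g y ∂ν.toMeasure - ∫ y, g y ∂μ.toMeasure))

/-- `u = u(v, μ)` is fully `C²` with the first derivatives `D_v u(v, μ)`, `D_μ u(v, μ)(y)` and
the second derivatives `D_v D_v u`, `D_μ D_v u`, `D_v D_μ u`, `D_y D_μ u`, `D_μ D_μ u`: all of
these exist everywhere and are jointly continuous in all their arguments. -/
structure IsFullyC2 (u : V → P2 W → ℝ)
    (Dv : V → P2 W → V →L[ℝ] ℝ)
    (Dm : V → P2 W → W → W →L[ℝ] ℝ)
    (DvDv : V → P2 W → V →L[ℝ] V →L[ℝ] ℝ)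
    (DmDv : V → P2 W → W → W →L[ℝ] V →L[ℝ] ℝ)
    (DvDm : V → P2 W → W → V →L[ℝ] W →L[ℝ] ℝ)
    (DyDm : V → P2 W → W → W →L[ℝ] W →L[ℝ] ℝ)
    (DmDm : V → P2 W → W → W → W →L[ℝ] W →L[ℝ] ℝ) : Prop where
  continuous : Continuous fun q : V × P2 W => u q.1 q.2
  hasDv : ∀ v μ, HasFDerivAt (fun v => u v μ) (Dv v μ) v
  hasDm : ∀ v μ, HasLDeriv (fun μ => u v μ) (Dm v μ) μ
  hasDvDv : ∀ v μ, HasFDerivAt (fun v => Dv v μ) (DvDv v μ) v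
  hasDmDv : ∀ v μ, HasLDeriv (fun μ => Dv v μ) (DmDv v μ) μ
  hasDvDm : ∀ v μ y, HasFDerivAt (fun v => Dm v μ y) (DvDm v μ y) v
  hasDyDm : ∀ v μ y, HasFDerivAt (fun y => Dm v μ y) (DyDm v μ y) y
  hasDmDm : ∀ v μ y, HasLDeriv (fun μ => Dm v μ y) (DmDm v μ y) μ
  continuous_Dv : Continuous fun q : V × P2 W => Dv q.1 q.2
  continuous_Dm : Continuous fun q : V × P2 W × W => Dm q.1 q.2.1 q.2.2
  continuous_DvDv : Continuous fun q : V × P2 W => DvDv q.1 q.2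
  continuous_DmDv : Continuous fun q : V × P2 W × W => DmDv q.1 q.2.1 q.2.2
  continuous_DvDm : Continuous fun q : V × P2 W × W => DvDm q.1 q.2.1 q.2.2
  continuous_DyDm : Continuous fun q : V × P2 W × W => DyDm q.1 q.2.1 q.2.2
  continuous_DmDm : Continuous fun q : V × P2 W × W × W => DmDm q.1 q.2.1 q.2.2.1 q.2.2.2

/-- `u` is fully `C²`, all of its second derivatives are uniformly bounded, and its first
derivative `D_μ u` is uniformly bounded. -/
def IsFullyC2Bounded (u : V → P2 W → ℝ) : Prop :=
  ∃ Dv Dm DvDv DmDv DvDm DyDm DmDm, IsFullyC2 u Dv Dm DvDv DmDv DvDm DyDm DmDm ∧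
    ∃ K : ℝ, ∀ v μ y y', ‖DvDv v μ‖ ≤ K ∧ ‖DmDv v μ y‖ ≤ K ∧ ‖DvDm v μ y‖ ≤ K ∧
      ‖DyDm v μ y‖ ≤ K ∧ ‖DmDm v μ y y'‖ ≤ K ∧ ‖Dm v μ y‖ ≤ K

end Calculus

/-! ### Lagrangians, Hamiltonians and the fixed-point equations -/

/-- `ℝ^d` with its Euclidean norm. -/
abbrev Rd (d : ℕ) : Type := EuclideanSpace ℝ (Fin d)

/-- `ℝ^d × ℝ^d` with its Euclidean norm, `|(x, a)|² = |x|² + |a|²`. -/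
abbrev RdRd (d : ℕ) : Type := WithLp 2 (Rd d × Rd d)

/-- The point `(x, a)` of `ℝ^d × ℝ^d`. -/
abbrev mk {d : ℕ} (x a : Rd d) : RdRd d := WithLp.toLp 2 (x, a)

/-- The type of the Lagrangian `L(x, a, μ)` and of the Hamiltonian `H(x, p, μ)`. -/
abbrev Lagrangian (d : ℕ) : Type := Rd d → Rd d → P2 (RdRd d) → ℝ

variable {d : ℕ}

/-- The gradient `D_x L(x, a, μ)` in the first variable. -/
def gradX (L : Lagrangian d) (x a : Rd d) (μ : P2 (RdRd d)) : Rd d :=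
  gradient (fun x' => L x' a μ) x

/-- The gradient `D_a L(x, a, μ)` in the second variable. -/
def gradA (L : Lagrangian d) (x a : Rd d) (μ : P2 (RdRd d)) : Rd d :=
  gradient (fun a' => L x a' μ) a

/-- The Hamiltonian `H(x, p, μ) = sup_a {- a · p - L(x, a, μ)}`. -/
def hamiltonian (L : Lagrangian d) : Lagrangian d :=
  fun x p μ => ⨆ a : Rd d, (-inner ℝ a p - L x a μ)

/-- The gradient `D_p H(x, p, μ)` of the Hamiltonian in the second variable. -/
def gradPH (L : Lagrangian d) (x p : Rd d) (μ : P2 (RdRd d)) : Rd d :=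
  gradA (hamiltonian L) x p μ

/-- For every `(x, a, μ)` the map `D : (x, a, μ) ↦ D(x, a, μ)` has a flat derivative
`(δ/δm) D(x, a, μ, x', a')`, and this is Lipschitz continuous in all variables, with respect to
`d₁` in the measure variable. -/
def HasLipschitzFlatDeriv (D : Rd d → Rd d → P2 (RdRd d) → Rd d) : Prop :=
  ∃ g : Rd d → Rd d → P2 (RdRd d) → RdRd d → Rd d,
    (∀ x a μ, HasFlatDeriv (fun μ => D x a μ) (g x a μ) μ) ∧
    ∃ K : ℝ, ∀ x a μ y x' a' μ' y',
      ‖g x a μ y - g x' a' μ' y'‖ ≤ K * (‖x - x'‖ + ‖a - a'‖ + d1 μ μ' + ‖y - y'‖)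

/-- The regularity and growth assumptions on the Lagrangian. -/
structure Regular (L : Lagrangian d) : Prop where
  /-- `L` is fully `C²` with bounded second derivatives and bounded `D_μ L`. -/
  fullyC2 : IsFullyC2Bounded fun (z : RdRd d) μ => L z.fst z.snd μ
  /-- `D_{aa} L ≥ c I` for some `c > 0`. -/
  convex : ∃ c > 0, ∀ x a μ (h : Rd d),
    c * ‖h‖ ^ 2 ≤ inner ℝ (fderiv ℝ (fun a' => gradA L x a' μ) a h) h
  /-- Quadratic growth and coercivity. -/
  coercive : ∃ C > 0, ∀ x a μ,
    C⁻¹ * ‖a‖ ^ 2 - C * (1 + ‖x‖ ^ 2 + d2 μ (P2.dirac 0)) ≤ L x a μ ∧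
    L x a μ ≤ C * ‖a‖ ^ 2 + C * (1 + ‖x‖ ^ 2 + d2 μ (P2.dirac 0))
  flatX : HasLipschitzFlatDeriv (gradX L)
  flatA : HasLipschitzFlatDeriv (gradA L)

/-- The joint law of two square-integrable random vectors `X` and `α`. -/
def jointLaw {Ω : Type} [MeasurableSpace Ω] (P : Measure Ω) [IsProbabilityMeasure P]
    (X α : Ω → Rd d) (hX : MemLp X 2 P) (hα : MemLp α 2 P) : P2 (RdRd d) :=
  P2.law P (fun ω => mk (X ω) (α ω)) (memLp_prodLp_iff.2 ⟨hX, hα⟩)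

/-- The weak displacement monotonicity of the Lagrangian. -/
def WeaklyDisplacementMonotone (L : Lagrangian d) : Prop :=
  ∃ cA > 0, ∃ cX ≥ 0, ∀ (Ω : Type) [MeasurableSpace Ω] (P : Measure Ω) [IsProbabilityMeasure P]
    (X α X' α' : Ω → Rd d) (hX : MemLp X 2 P) (hα : MemLp α 2 P)
    (hX' : MemLp X' 2 P) (hα' : MemLp α' 2 P),
    cA * ∫ ω, ‖α ω - α' ω‖ ^ 2 ∂P - cX * ∫ ω, ‖X ω - X' ω‖ ^ 2 ∂P ≤
      ∫ ω, (inner ℝ (gradA L (X ω) (α ω) (jointLaw P X α hX hα) -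
            gradA L (X' ω) (α' ω) (jointLaw P X' α' hX' hα')) (α ω - α' ω) +
          inner ℝ (gradX L (X ω) (α ω) (jointLaw P X α hX hα) -
            gradX L (X' ω) (α' ω) (jointLaw P X' α' hX' hα')) (X ω - X' ω)) ∂P

/-- The mean field fixed-point equation for `μ`, given `ν`: `μ` is the image of `ν` under the map
`(x, p) ↦ (x, - D_p H(x, p, μ))`. -/
def IsMeanFieldFixedPoint (L : Lagrangian d) (ν μ : P2 (RdRd d)) : Prop :=
  ν.toMeasure.map (fun z => mk z.fst (-gradPH L z.fst z.snd μ)) = μ.toMeasure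

/-- The empirical measure `m^N_{x,a}` of the pairs `(x^j, a^j)`, `j = 1, …, N`. -/
def empiricalAll {N : ℕ} (x a : Fin N → Rd d) : P2 (RdRd d) :=
  P2.empirical Finset.univ fun j => mk (x j) (a j)

/-- The empirical measure `m^{N,-i}_{x,a}` of the pairs `(x^j, a^j)` with `j ≠ i`
(meaningful for `N ≥ 2`). -/
def empiricalWithout {N : ℕ} (i : Fin N) (x a : Fin N → Rd d) : P2 (RdRd d) :=
  P2.empirical (Finset.univ.erase i) fun j => mk (x j) (a j)

/-- The `N`-player fixed-point equations for `a`, given `(x, p)`: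
`a^i = - D_p H(x^i, p^i, m^{N,-i}_{x,a})` for all `i`. -/
def IsPlayerFixedPoint (L : Lagrangian d) {N : ℕ} (x p a : Fin N → Rd d) : Prop :=
  ∀ i, a i = -gradPH L (x i) (p i) (empiricalWithout i x a)

end MFGC

/-!
The condition `a = -D_p H(x, p, μ)` is the first-order condition `D_a L(x, a, μ) = -p` for the
supremum that defines `H`; this uses only that `L` is uniformly convex in `a` with Lipschitz
gradient (`Regular.eq_neg_gradPH_iff`). Both fixed-point problems thus become equations for a
vector field in a Hilbert space, and both are solved by the same principle: a Lipschitz and strongly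
monotone operator is onto (`exists_eq_of_stronglyMonotone`) with Lipschitz inverse
(`mul_norm_le_of_mul_sq_le_inner`).

For the mean field equation, the Hilbert space is `L²(Ω, P)` for a probability space carrying
`(X, p) ∼ ν`, and the operator is `α ↦ D_a L(X, α, law(X, α))`. Weak displacement monotonicity,
applied to two controls with the same state `X`, says precisely that it is strongly monotone. It is
Lipschitz because a Lipschitz flat derivative makes `D_a L` Lipschitz in the measure with respect to
`d₁` (`norm_sub_law_le_of_flatDeriv`). Stability under changes of `(X, p)`
(`GradABounds.stability`), applied on the space of a coupling of `ν₁` and `ν₂`, gives uniqueness and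
the Lipschitz bound for `Φ`.

For `N` players, the Hilbert space is `(ℝ^d)^N`. With the full empirical measure `m^N` in place of
`m^{N,-i}`, the vector field `(D_a L(x^i, a^i, m^N))_i` is the mean field operator for the uniform
measure on the players, hence strongly monotone. The difference between the two vector fields is
expressed through the flat derivative along the segment from `m^N` to `m^{N,-i}`. Since
`m^{N,-i} - m^N = (m^{N,-i} - δ_{z^i}) / N` and the flat derivative is Lipschitz in all variables,
this difference is Lipschitz in the controls with constant `O(1/N)`
(`GradABounds.norm_perturbation_sub_le`) and does not destroy the monotonicity when `N` is large.
The same representation bounds the difference itself by `1/N` times the spread of the points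
`(x^i, a^i)` (`GradABounds.norm_perturbation_sq_le`). The solution for `x = p = 0` has all controls
equal, so by the Lipschitz bound the spread is controlled by `∑ (|x^i|² + |p^i|²)`, and strong
monotonicity turns this into the estimate of the distance to `Φ(m^N)` (`GradABounds.d2_sq_le`).
-/

namespace MFGC

/-! ### Strongly monotone operators on a Hilbert space -/

section Monotone

variable {E : Type*} [NormedAddCommGroup E] [InnerProductSpace ℝ E]

theorem mul_norm_le_of_mul_sq_le_inner {c : ℝ} {y w : E}
    (h : c * ‖w‖ ^ 2 ≤ inner ℝ y w) : c * ‖w‖ ≤ ‖y‖ := by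
  rcases (norm_nonneg w).eq_or_lt with h0 | h0
  · rw [← h0]; simp
  · have := h.trans (real_inner_le_norm y w)
    have h2 : (c * ‖w‖) * ‖w‖ ≤ ‖y‖ * ‖w‖ := by nlinarith
    exact le_of_mul_le_mul_right h2 h0

/-- A Lipschitz continuous and strongly monotone operator on a Hilbert space is onto: for small
`τ > 0` the map `u ↦ u - τ (F u - f)` is a contraction. -/
theorem exists_eq_of_stronglyMonotone [CompleteSpace E] {F : E → E} {c K : ℝ} (hc : 0 < c)
    (hF : ∀ u v, c * ‖u - v‖ ^ 2 ≤ inner ℝ (F u - F v) (u - v))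
    (hK : ∀ u v, ‖F u - F v‖ ≤ K * ‖u - v‖) (f : E) : ∃ u, F u = f := by
  -- `M` is a Lipschitz constant with `c ≤ M`, so that `q = 1 - c² / M²` lies in `[0, 1)`.
  obtain ⟨M, hM⟩ : ∃ M, M = max K c := ⟨_, rfl⟩
  have hcM : c ≤ M := hM ▸ le_max_right _ _
  have hM0 : 0 < M := hc.trans_le hcM
  have hKM : ∀ u v, ‖F u - F v‖ ≤ M * ‖u - v‖ := fun u v =>
    (hK u v).trans (by gcongr; exact hM ▸ le_max_left _ _)
  obtain ⟨τ, hτ⟩ : ∃ τ, τ = c / M ^ 2 := ⟨_, rfl⟩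
  have hτ0 : 0 < τ := hτ ▸ by positivity
  have hτM : τ * M ^ 2 = c := by rw [hτ]; field_simp
  have hq0 : 0 ≤ 1 - τ * c := by
    have : τ * c ≤ 1 := by
      rw [hτ, div_mul_eq_mul_div, div_le_one (by positivity)]; nlinarith
    linarith
  have hq1 : √(1 - τ * c) < 1 := by
    rw [Real.sqrt_lt' one_pos]; nlinarith
  have hcontr : ContractingWith ⟨√(1 - τ * c), Real.sqrt_nonneg _⟩
      (fun u => u - τ • (F u - f)) := by
    refine ⟨by exact_mod_cast hq1, LipschitzWith.of_dist_le_mul fun u v => ?_⟩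
    rw [dist_eq_norm, dist_eq_norm]
    have e : u - τ • (F u - f) - (v - τ • (F v - f)) = (u - v) - τ • (F u - F v) := by
      simp only [smul_sub]; abel
    rw [e]
    change _ ≤ √(1 - τ * c) * _
    refine abs_le_of_sq_le_sq' ?_ (by positivity) |>.2
    rw [mul_pow, Real.sq_sqrt hq0, norm_sub_sq_real, real_inner_smul_right, norm_smul,
      Real.norm_of_nonneg hτ0.le, real_inner_comm]
    have h1 := hF u v
    have h2 : ‖F u - F v‖ ^ 2 ≤ M ^ 2 * ‖u - v‖ ^ 2 := by
      rw [← mul_pow]; exact pow_le_pow_left₀ (norm_nonneg _) (hKM u v) 2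
    have h3 := mul_le_mul_of_nonneg_left h1 hτ0.le
    have h4 : (τ * ‖F u - F v‖) ^ 2 ≤ τ * c * ‖u - v‖ ^ 2 := by
      calc (τ * ‖F u - F v‖) ^ 2 = τ ^ 2 * ‖F u - F v‖ ^ 2 := by ring
        _ ≤ τ ^ 2 * (M ^ 2 * ‖u - v‖ ^ 2) := by gcongr
        _ = τ * (τ * M ^ 2) * ‖u - v‖ ^ 2 := by ring
        _ = _ := by rw [hτM]
    nlinarith
  have : Nonempty E := ⟨f⟩
  refine ⟨ContractingWith.fixedPoint _ hcontr, ?_⟩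
  have h := hcontr.fixedPoint_isFixedPt
  rw [Function.IsFixedPt, sub_eq_self, smul_eq_zero, sub_eq_zero] at h
  exact h.resolve_left hτ0.ne'

/-- A differentiable vector field whose derivative is bounded below by `c` is strongly monotone. -/
theorem stronglyMonotone_of_fderiv {G : E → E} {c : ℝ} (hG : Differentiable ℝ G)
    (hc : ∀ a h, c * ‖h‖ ^ 2 ≤ inner ℝ (fderiv ℝ G a h) h) (a b : E) :
    c * ‖a - b‖ ^ 2 ≤ inner ℝ (G a - G b) (a - b) := by
  have hd : ∀ t : ℝ, HasDerivAt (fun t : ℝ => inner ℝ (G (b + t • (a - b))) (a - b))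
      (inner ℝ (fderiv ℝ G (b + t • (a - b)) (a - b)) (a - b)) t := fun t => by
    have h1 : HasDerivAt (fun t : ℝ => b + t • (a - b)) (a - b) t := by
      simpa using ((hasDerivAt_id t).smul_const (a - b)).const_add b
    have h2 := (hG (b + t • (a - b))).hasFDerivAt.comp_hasDerivAt t h1
    simpa using h2.inner ℝ (hasDerivAt_const t (a - b))
  have := mul_sub_le_image_sub_of_le_deriv (fun t => (hd t).differentiableAt)
    (fun t => by rw [(hd t).deriv]; exact hc _ _) (x := 0) (y := 1) zero_le_one
  simpa [inner_sub_left] using this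

/-- A function with monotone gradient lies above its tangent planes. -/
theorem inner_gradient_le_of_monotone [CompleteSpace E] {f : E → ℝ} {G : E → E}
    (hf : ∀ a, HasGradientAt f (G a) a) (hG : ∀ a b, 0 ≤ inner ℝ (G a - G b) (a - b)) (a b : E) :
    f b + inner ℝ (G b) (a - b) ≤ f a := by
  have hd : ∀ t : ℝ, HasDerivAt (fun t : ℝ => f (b + t • (a - b)))
      (inner ℝ (G (b + t • (a - b))) (a - b)) t := fun t => by
    have h1 : HasDerivAt (fun t : ℝ => b + t • (a - b)) (a - b) t := by
      simpa using ((hasDerivAt_id t).smul_const (a - b)).const_add b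
    have h2 := (hf (b + t • (a - b))).hasFDerivAt.comp_hasDerivAt t h1
    rw [InnerProductSpace.toDual_apply_apply] at h2
    exact h2
  have := (convex_Icc (0 : ℝ) 1).mul_sub_le_image_sub_of_le_deriv
    (fun t _ => (hd t).continuousAt.continuousWithinAt)
    (fun t _ => (hd t).differentiableAt.differentiableWithinAt) (C := inner ℝ (G b) (a - b))
    (fun t ht => by
      rw [interior_Icc] at ht
      rw [(hd t).deriv]
      have h := hG (b + t • (a - b)) b
      rw [add_sub_cancel_left, real_inner_smul_right, inner_sub_left] at h
      have := nonneg_of_mul_nonneg_right h ht.1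
      linarith) 0 (by simp) 1 (by simp) zero_le_one
  simp at this
  linarith

end Monotone

/-! ### The Lagrangian and its Hamiltonian at a fixed measure -/

section Static

variable {d : ℕ} {L : Lagrangian d}

/-- The linear embedding `a ↦ (0, a)`. -/
def embA (d : ℕ) : Rd d →L[ℝ] RdRd d :=
  (WithLp.prodContinuousLinearEquiv 2 ℝ (Rd d) (Rd d)).symm.toContinuousLinearMap ∘L
    ContinuousLinearMap.inr ℝ (Rd d) (Rd d)

theorem hasFDerivAt_mk (x a : Rd d) : HasFDerivAt (fun a' => mk x a') (embA d) a :=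
  (WithLp.prodContinuousLinearEquiv 2 ℝ (Rd d) (Rd d)).symm.hasFDerivAt.comp a
    (hasFDerivAt_prodMk_right x a)

theorem norm_mk_sq (x a : Rd d) : ‖mk x a‖ ^ 2 = ‖x‖ ^ 2 + ‖a‖ ^ 2 := by
  exact WithLp.prod_norm_sq_eq_of_L2 _

theorem mk_sub_mk (x a x' a' : Rd d) : mk x a - mk x' a' = mk (x - x') (a - a') := rfl

theorem norm_mk_sub_mk_left (x x' a : Rd d) : ‖mk x a - mk x' a‖ = ‖x - x'‖ := by
  rw [mk_sub_mk, sub_self, ← sq_eq_sq₀ (norm_nonneg _) (norm_nonneg _), norm_mk_sq, norm_zero]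
  ring

theorem norm_mk_sub_mk_right (x a a' : Rd d) : ‖mk x a - mk x a'‖ = ‖a - a'‖ := by
  rw [mk_sub_mk, sub_self, ← sq_eq_sq₀ (norm_nonneg _) (norm_nonneg _), norm_mk_sq, norm_zero]
  ring

theorem norm_mk_le (x a : Rd d) : ‖mk x a‖ ≤ ‖x‖ + ‖a‖ := by
  refine abs_le_of_sq_le_sq' ?_ (by positivity) |>.2
  rw [norm_mk_sq]
  nlinarith [norm_nonneg x, norm_nonneg a]

/-- The analytic consequences of the `C²` bounds and of the convexity of `L` for the function
`a ↦ L(x, a, μ)`: the gradient `D_a L` exists, is Lipschitz continuous in `(x, a)`, and is strongly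
monotone in `a`. -/
theorem Regular.gradA_static (hL : Regular L) :
    (∀ x a μ, HasGradientAt (fun a' => L x a' μ) (gradA L x a μ) a) ∧
    (∃ K : ℝ, 0 ≤ K ∧ ∀ x a x' a' μ,
      ‖gradA L x a μ - gradA L x' a' μ‖ ≤ K * (‖x - x'‖ + ‖a - a'‖)) ∧
    ∃ c > 0, ∀ x μ a a',
      c * ‖a - a'‖ ^ 2 ≤ inner ℝ (gradA L x a μ - gradA L x a' μ) (a - a') := by
  obtain ⟨Dv, Dm, DvDv, DmDv, DvDm, DyDm, DmDm, h, K, hK⟩ := hL.fullyC2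
  have hfd : ∀ x a μ, HasFDerivAt (fun a' => L x a' μ) (Dv (MFGC.mk x a) μ ∘L embA d) a :=
    fun x a μ => (h.hasDv (MFGC.mk x a) μ).comp a (hasFDerivAt_mk x a)
  have hgrad : ∀ x a μ, HasGradientAt (fun a' => L x a' μ)
      ((InnerProductSpace.toDual ℝ (Rd d)).symm (Dv (MFGC.mk x a) μ ∘L embA d)) a := fun x a μ =>
    hasFDerivAt_iff_hasGradientAt.1 (hfd x a μ)
  have heq : ∀ x a μ, gradA L x a μ =
      (InnerProductSpace.toDual ℝ (Rd d)).symm (Dv (MFGC.mk x a) μ ∘L embA d) :=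
    fun x a μ => (hgrad x a μ).gradient
  have hK0 : 0 ≤ K := (norm_nonneg (DvDv 0 (P2.dirac 0))).trans (hK 0 (P2.dirac 0) 0 0).1
  refine ⟨fun x a μ => heq x a μ ▸ hgrad x a μ,
    ⟨K * ‖embA d‖, by positivity, fun x a x' a' μ => ?_⟩, ?_⟩
  · rw [heq, heq, ← map_sub, LinearIsometryEquiv.norm_map, ← ContinuousLinearMap.sub_comp]
    have h1 : ‖Dv (MFGC.mk x a) μ - Dv (MFGC.mk x' a') μ‖ ≤ K * ‖MFGC.mk x a - MFGC.mk x' a'‖ :=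
      convex_univ.norm_image_sub_le_of_norm_hasFDerivWithin_le
        (fun z _ => (h.hasDvDv z μ).hasFDerivWithinAt) (fun z _ => (hK z μ 0 0).1) trivial trivial
    calc _ ≤ ‖Dv (MFGC.mk x a) μ - Dv (MFGC.mk x' a') μ‖ * ‖embA d‖ :=
        ContinuousLinearMap.opNorm_comp_le _ _
      _ ≤ (K * (‖x - x'‖ + ‖a - a'‖)) * ‖embA d‖ := by
        gcongr
        exact h1.trans (by gcongr; exact norm_mk_le _ _)
      _ = _ := by ring
  · obtain ⟨c, hc, hconv⟩ := hL.convex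
    refine ⟨c, hc, fun x μ a a' => stronglyMonotone_of_fderiv (fun a => ?_) (hconv x · μ) a a'⟩
    simp only [heq]
    have h1 : DifferentiableAt ℝ (fun a => Dv (MFGC.mk x a) μ) a :=
      ((h.hasDvDv (MFGC.mk x a) μ).comp a (hasFDerivAt_mk x a)).differentiableAt
    have h2 : DifferentiableAt ℝ (fun a => Dv (MFGC.mk x a) μ ∘L embA d) a :=
      h1.clm_comp (differentiableAt_const _)
    exact (InnerProductSpace.toDual ℝ (Rd d)).symm.differentiableAt.comp a h2

/-- Duality between `L` and `H`: the equation `a = -D_p H(x, p, μ)` is the first-order condition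
`D_a L(x, a, μ) = -p` of the maximization problem that defines `H(x, p, μ)`. -/
theorem Regular.eq_neg_gradPH_iff (hL : Regular L) (x p a : Rd d) (μ : P2 (RdRd d)) :
    a = -gradPH L x p μ ↔ gradA L x a μ = -p := by
  obtain ⟨hgrad, ⟨K, hK0, hK⟩, c, hc, hmono⟩ := hL.gradA_static
  -- the unique maximizer `s q` for the momentum `q`
  have hex : ∀ q, ∃ b, gradA L x b μ = -q := fun q =>
    exists_eq_of_stronglyMonotone hc (hmono x μ) (fun u v => by simpa using hK x u x v μ) (-q)
  choose s hs using hex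
  have hsup : ∀ q b, -inner ℝ b q - L x b μ ≤ -inner ℝ (s q) q - L x (s q) μ := fun q b => by
    have := inner_gradient_le_of_monotone (fun a => hgrad x a μ)
      (fun a b => (by positivity : 0 ≤ c * ‖a - b‖ ^ 2).trans (hmono x μ a b)) b (s q)
    rw [hs, inner_neg_left, inner_sub_right, real_inner_comm, real_inner_comm (s q)] at this
    linarith
  have hH : ∀ q, hamiltonian L x q μ = -inner ℝ (s q) q - L x (s q) μ := fun q =>
    le_antisymm (ciSup_le (hsup q)) (le_ciSup (f := fun a => -inner ℝ a q - L x a μ)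
      ⟨_, by rintro _ ⟨b, rfl⟩; exact hsup q b⟩ (s q))
  have hlip : ∀ q q', c * ‖s q - s q'‖ ≤ ‖q - q'‖ := fun q q' => by
    have := mul_norm_le_of_mul_sq_le_inner (hmono x μ (s q) (s q'))
    rwa [hs, hs, ← neg_sub', norm_neg] at this
  have hgradH : HasGradientAt (fun q => hamiltonian L x q μ) (-s p) p := by
    rw [hasGradientAt_iff_isLittleO]
    have hO : (fun q => hamiltonian L x q μ - hamiltonian L x p μ - inner ℝ (-s p) (q - p))
        =O[𝓝 p] fun q => ‖q - p‖ ^ 2 := by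
      refine Asymptotics.IsBigO.of_bound c⁻¹ (Eventually.of_forall fun q => ?_)
      have h1 := hsup q (s p)
      have h2 := hsup p (s q)
      have h3 : inner ℝ (s p - s q) (q - p) ≤ c⁻¹ * ‖q - p‖ ^ 2 := by
        refine (real_inner_le_norm _ _).trans ?_
        have := hlip p q
        rw [norm_sub_rev p q] at this
        rw [pow_two, ← mul_assoc]
        gcongr
        rw [inv_mul_eq_div, le_div_iff₀ hc]
        linarith
      rw [hH, hH]
      simp only [inner_sub_right, inner_sub_left, inner_neg_left] at h3 ⊢
      rw [Real.norm_eq_abs, Real.norm_eq_abs, abs_of_nonneg, abs_of_nonneg (by positivity)]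
      · linarith
      · linarith
    exact hO.trans_isLittleO (by
      have : (fun q => ‖q - p‖ ^ 2) =o[𝓝 p] fun q => ‖q - p‖ := by
        have h0 : Tendsto (fun q => ‖q - p‖) (𝓝 p) (𝓝 0) := tendsto_norm_sub_self p
        simpa [pow_two] using ((Asymptotics.isLittleO_one_iff ℝ).2 h0).mul_isBigO
          (Asymptotics.isBigO_refl (fun q => ‖q - p‖) (𝓝 p))
      exact this.of_norm_right)
  have hval : gradPH L x p μ = -s p := hgradH.gradient
  rw [hval, neg_neg]
  refine ⟨fun h => h ▸ hs p, fun h => ?_⟩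
  have := mul_norm_le_of_mul_sq_le_inner (hmono x μ a (s p))
  rw [hs, h, sub_self, norm_zero] at this
  have h0 : ‖a - s p‖ ≤ 0 := by
    by_contra hn
    push Not at hn
    exact absurd this (not_le.2 (by positivity))
  simpa [sub_eq_zero] using h0

end Static

/-! ### The mean value inequality for flat derivatives -/

section Flat

variable {W F : Type*} [NormedAddCommGroup W] [MeasurableSpace W]
  [NormedAddCommGroup F] [NormedSpace ℝ F]

theorem P2.toMeasure_mix (t : I) (μ ν : P2 W) :
    (P2.mix t μ ν).toMeasure =
      ENNReal.ofReal (1 - t) • μ.toMeasure + ENNReal.ofReal t • ν.toMeasure := rfl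

theorem P2.ext {μ ν : P2 W} (h : μ.toMeasure = ν.toMeasure) : μ = ν := Subtype.ext h

theorem P2.mix_zero (μ ν : P2 W) : P2.mix 0 μ ν = μ :=
  P2.ext (by simp [P2.toMeasure_mix])

theorem P2.mix_one (μ ν : P2 W) : P2.mix 1 μ ν = ν :=
  P2.ext (by simp [P2.toMeasure_mix])

theorem P2.mix_symm (t : I) (μ ν : P2 W) : P2.mix (σ t) ν μ = P2.mix t μ ν :=
  P2.ext (by simp [P2.toMeasure_mix, add_comm])

theorem P2.mix_mix (s t r : I) (h : (r : ℝ) = t + s * (1 - t)) (μ ν : P2 W) :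
    P2.mix s (P2.mix t μ ν) ν = P2.mix r μ ν := by
  refine P2.ext ?_
  have h1 : (1 - r : ℝ) = (1 - s) * (1 - t) := by rw [h]; ring
  have h2 : (r : ℝ) = (1 - s) * t + s := by rw [h]; ring
  have hs : (0 : ℝ) ≤ 1 - s := by linarith [s.2.2]
  rw [P2.toMeasure_mix, P2.toMeasure_mix, P2.toMeasure_mix, h1, h2, ENNReal.ofReal_mul hs,
    ENNReal.ofReal_add (mul_nonneg hs t.2.1) s.2.1, ENNReal.ofReal_mul hs, smul_add, add_smul,
    smul_smul, smul_smul, add_assoc]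

theorem P2.integral_mix (t : I) (μ ν : P2 W) {g : W → F} (hμ : Integrable g μ.toMeasure)
    (hν : Integrable g ν.toMeasure) :
    ∫ y, g y ∂(P2.mix t μ ν).toMeasure =
      (1 - t : ℝ) • ∫ y, g y ∂μ.toMeasure + (t : ℝ) • ∫ y, g y ∂ν.toMeasure := by
  rw [P2.toMeasure_mix, integral_add_measure (hμ.smul_measure ENNReal.ofReal_ne_top)
    (hν.smul_measure ENNReal.ofReal_ne_top), integral_smul_measure, integral_smul_measure,
    ENNReal.toReal_ofReal (by linarith [t.2.2]), ENNReal.toReal_ofReal t.2.1]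

/-- The values of `f` along the segment from `μ` to `ν`, extended by constants to a function on
all of `ℝ`. -/
def segmentMap {F : Type*} (f : P2 W → F) (μ ν : P2 W) (t : ℝ) : F :=
  f (P2.mix (Set.projIcc 0 1 zero_le_one t) μ ν)

theorem segmentMap_one_sub {F : Type*} (f : P2 W → F) (μ ν : P2 W) (t : ℝ) :
    segmentMap f ν μ (1 - t) = segmentMap f μ ν t := by
  rw [segmentMap, segmentMap, ← P2.mix_symm]
  congr 2
  ext
  simp only [Set.coe_projIcc, unitInterval.coe_symm_eq]
  rcases le_total t 0 with h | h
  · rw [min_eq_left (by linarith), max_eq_right (by norm_num), min_eq_right (by linarith),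
      max_eq_left h]; simp
  · rcases le_total t 1 with h' | h'
    · rw [min_eq_right (by linarith), max_eq_right (by linarith), min_eq_right h',
        max_eq_right h, sub_sub_cancel]
    · rw [min_eq_right (by linarith), max_eq_left (by linarith), min_eq_left h',
        max_eq_right zero_le_one]; simp

variable {f : P2 W → F} {g : P2 W → W → F}

/-- Moving along the segment from its point `μ_t` towards the endpoint `ν` turns the flat
derivative at `μ_t` into a right derivative in `t`; the factor `1 - t` lost by the change of the
base point is regained from `ν - μ_t = (1 - t) (ν - μ)`. -/
theorem hasDerivWithinAt_segmentMap (hf : ∀ μ, HasFlatDeriv f (g μ) μ) (μ ν : P2 W) (t : I)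
    (ht : (t : ℝ) < 1) :
    HasDerivWithinAt (segmentMap f μ ν) (∫ y, g (P2.mix t μ ν) y ∂ν.toMeasure -
      ∫ y, g (P2.mix t μ ν) y ∂μ.toMeasure) (Set.Ici (t : ℝ)) t := by
  have ht' : (0 : ℝ) < 1 - t := by linarith
  rw [hasDerivWithinAt_iff_tendsto_slope, Set.Ici_sdiff_left]
  obtain ⟨-, hint, hlim⟩ := hf (P2.mix t μ ν)
  have hlim := hlim ν
  -- the parameter `s = (r - t) / (1 - t)` of the point `μ_r` on the segment from `μ_t` to `ν`
  have hs : Tendsto (fun r : ℝ => Set.projIcc (0 : ℝ) 1 zero_le_one ((r - t) / (1 - t)))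
      (𝓝[>] (t : ℝ)) (𝓝[>] (0 : I)) := by
    refine tendsto_nhdsWithin_iff.2 ⟨?_, ?_⟩
    · have hc : Continuous fun r : ℝ => Set.projIcc (0 : ℝ) 1 zero_le_one ((r - t) / (1 - t)) :=
        continuous_projIcc.comp (by fun_prop)
      have h0 : Set.projIcc (0 : ℝ) 1 zero_le_one (((t : ℝ) - t) / (1 - t)) = 0 := by
        rw [sub_self, zero_div]; exact Set.projIcc_left _
      exact tendsto_nhdsWithin_of_tendsto_nhds (h0 ▸ hc.tendsto (t : ℝ))
    · filter_upwards [self_mem_nhdsWithin] with r hr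
      have : (0 : ℝ) < (r - t) / (1 - t) := div_pos (sub_pos.2 hr) ht'
      rw [Set.mem_Ioi, ← Subtype.coe_lt_coe, Set.coe_projIcc]
      simp [this]
  have key := (hlim.comp hs).const_smul (1 - (t : ℝ))⁻¹
  rw [P2.integral_mix t μ ν (hint μ) (hint ν)] at key
  have e : (1 - (t : ℝ))⁻¹ • (∫ y, g (P2.mix t μ ν) y ∂ν.toMeasure -
      ((1 - t : ℝ) • ∫ y, g (P2.mix t μ ν) y ∂μ.toMeasure +
        (t : ℝ) • ∫ y, g (P2.mix t μ ν) y ∂ν.toMeasure)) =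
      ∫ y, g (P2.mix t μ ν) y ∂ν.toMeasure - ∫ y, g (P2.mix t μ ν) y ∂μ.toMeasure := by
    rw [inv_smul_eq_iff₀ ht'.ne']
    module
  rw [e] at key
  refine key.congr' ?_
  filter_upwards [Ioo_mem_nhdsGT ht] with r hr
  have hr0 : (0 : ℝ) ≤ r := t.2.1.trans hr.1.le
  have hsI : (r - t) / (1 - t) ∈ Set.Icc (0 : ℝ) 1 :=
    ⟨div_nonneg (sub_nonneg.2 hr.1.le) ht'.le, (div_le_one ht').2 (by linarith [hr.2])⟩
  have hrI : r ∈ Set.Icc (0 : ℝ) 1 := ⟨hr0, hr.2.le⟩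
  simp only [Function.comp_apply, slope, segmentMap, vsub_eq_sub, Set.projIcc_val]
  rw [Set.projIcc_of_mem _ hsI, Set.projIcc_of_mem _ hrI,
    P2.mix_mix ⟨(r - t) / (1 - t), hsI⟩ t ⟨r, hrI⟩ (by simp only; field_simp; ring), smul_smul]
  congr 1
  simp only
  rw [← mul_inv, mul_div_cancel₀ _ ht'.ne']

theorem continuousOn_segmentMap (hf : ∀ μ, HasFlatDeriv f (g μ) μ) (μ ν : P2 W) :
    ContinuousOn (segmentMap f μ ν) (Set.Icc 0 1) := by
  have hright : ∀ μ ν : P2 W, ∀ t : I,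
      ContinuousWithinAt (segmentMap f μ ν) (Set.Icc (t : ℝ) 1) t := fun μ ν t => by
    rcases t.2.2.lt_or_eq with h | h
    · exact (hasDerivWithinAt_segmentMap hf μ ν t h).continuousWithinAt.mono
        Set.Icc_subset_Ici_self
    · rw [h, Set.Icc_self]; exact continuousWithinAt_singleton
  intro t ht
  rw [← Set.Icc_union_Icc_eq_Icc ht.1 ht.2]
  refine ContinuousWithinAt.union ?_ (hright μ ν ⟨t, ht⟩)
  have h : ContinuousWithinAt (segmentMap f ν μ) (Set.Icc (1 - t) 1) (1 - t) :=
    hright ν μ (σ ⟨t, ht⟩)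
  have h2 : ContinuousWithinAt (fun r : ℝ => 1 - r) (Set.Icc 0 t) t := by fun_prop
  have h3 := h.comp h2
    (fun r hr => ⟨by linarith [hr.2], by linarith [hr.1]⟩)
  simpa only [Function.comp_def, segmentMap_one_sub] using h3

/-- Mean value inequality for the difference of the increments of two functions along two
segments. -/
theorem norm_sub_sub_sub_le_of_flatDeriv {f' : P2 W → F} {g' : P2 W → W → F}
    (hf : ∀ μ, HasFlatDeriv f (g μ) μ) (hf' : ∀ μ, HasFlatDeriv f' (g' μ) μ)
    (μ ν μ' ν' : P2 W) {B : ℝ}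
    (hB : ∀ t, ‖(∫ y, g (P2.mix t μ ν) y ∂ν.toMeasure - ∫ y, g (P2.mix t μ ν) y ∂μ.toMeasure) -
      (∫ y, g' (P2.mix t μ' ν') y ∂ν'.toMeasure - ∫ y, g' (P2.mix t μ' ν') y ∂μ'.toMeasure)‖ ≤ B) :
    ‖(f ν - f μ) - (f' ν' - f' μ')‖ ≤ B := by
  have h := norm_image_sub_le_of_norm_deriv_right_le_segment
    (f := fun t => segmentMap f μ ν t - segmentMap f' μ' ν' t) (a := 0) (b := 1) (C := B)
    (f' := fun t =>
      (∫ y, g (P2.mix (Set.projIcc 0 1 zero_le_one t) μ ν) y ∂ν.toMeasure -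
        ∫ y, g (P2.mix (Set.projIcc 0 1 zero_le_one t) μ ν) y ∂μ.toMeasure) -
      (∫ y, g' (P2.mix (Set.projIcc 0 1 zero_le_one t) μ' ν') y ∂ν'.toMeasure -
        ∫ y, g' (P2.mix (Set.projIcc 0 1 zero_le_one t) μ' ν') y ∂μ'.toMeasure))
    ((continuousOn_segmentMap hf μ ν).sub (continuousOn_segmentMap hf' μ' ν'))
    (fun t ht => by
      have htI : t ∈ Set.Icc (0 : ℝ) 1 := ⟨ht.1, ht.2.le⟩
      rw [Set.projIcc_of_mem _ htI]
      exact (hasDerivWithinAt_segmentMap hf μ ν ⟨t, htI⟩ ht.2).sub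
        (hasDerivWithinAt_segmentMap hf' μ' ν' ⟨t, htI⟩ ht.2))
    (fun t _ => hB _) 1 (by simp)
  have h0 : Set.projIcc (0 : ℝ) 1 zero_le_one 0 = 0 := Set.projIcc_left _
  have h1 : Set.projIcc (0 : ℝ) 1 zero_le_one 1 = 1 := Set.projIcc_right _
  simp only [segmentMap, h0, h1, P2.mix_zero, P2.mix_one, sub_zero, mul_one] at h
  convert h using 2
  abel

/-- Mean value inequality along the segment from `μ` to `ν`. -/
theorem norm_sub_le_of_flatDeriv (hf : ∀ μ, HasFlatDeriv f (g μ) μ) (μ ν : P2 W) {B : ℝ}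
    (hB : ∀ t, ‖∫ y, g (P2.mix t μ ν) y ∂ν.toMeasure - ∫ y, g (P2.mix t μ ν) y ∂μ.toMeasure‖ ≤ B) :
    ‖f ν - f μ‖ ≤ B := by
  have h0 : ∀ μ : P2 W, HasFlatDeriv (fun _ => (0 : F)) (fun _ => 0) μ := fun μ =>
    ⟨continuous_const, fun _ => integrable_zero _ _ _, fun ν => by simpa using tendsto_const_nhds⟩
  simpa using norm_sub_sub_sub_le_of_flatDeriv hf h0 μ ν μ ν (B := B) (by simpa using hB)

end Flat

/-! ### Couplings, laws and Wasserstein distances -/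

section Integrals

variable {Ω E : Type*} [MeasurableSpace Ω] {P : Measure Ω} [NormedAddCommGroup E]

theorem lintegral_enorm_rpow_two {f : Ω → E} (hf : MemLp f 2 P) :
    ∫⁻ ω, ‖f ω‖ₑ ^ (2 : ℝ) ∂P = ENNReal.ofReal (∫ ω, ‖f ω‖ ^ 2 ∂P) := by
  rw [ofReal_integral_eq_lintegral_ofReal (hf.integrable_norm_pow two_ne_zero)
    (Eventually.of_forall fun _ => by positivity)]
  refine lintegral_congr fun ω => ?_
  rw [ENNReal.ofReal_pow (norm_nonneg _), ofReal_norm, ← ENNReal.rpow_natCast]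
  norm_num

theorem sq_integral_norm_le [IsProbabilityMeasure P] {f : Ω → E} (hf : MemLp f 2 P) :
    (∫ ω, ‖f ω‖ ∂P) ^ 2 ≤ ∫ ω, ‖f ω‖ ^ 2 ∂P := by
  have h := ProbabilityTheory.variance_nonneg (fun ω => ‖f ω‖) P
  rw [ProbabilityTheory.variance_eq_sub hf.norm] at h
  simpa using h

end Integrals

section Wasserstein

variable {W : Type*} [NormedAddCommGroup W] [MeasurableSpace W]

instance (μ : P2 W) : IsProbabilityMeasure μ.toMeasure := μ.2.1

theorem isProbabilityMeasure_of_mem_couplings {μ ν : P2 W} {γ : Measure (W × W)}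
    (hγ : γ ∈ couplings μ.toMeasure ν.toMeasure) : IsProbabilityMeasure γ := by
  refine ⟨?_⟩
  have := measure_univ (μ := μ.toMeasure)
  rwa [← hγ.1, Measure.map_apply measurable_fst .univ, Set.preimage_univ] at this

theorem prod_mem_couplings (μ ν : P2 W) :
    μ.toMeasure.prod ν.toMeasure ∈ couplings μ.toMeasure ν.toMeasure := by
  constructor
  · simp [Measure.map_fst_prod]
  · simp [Measure.map_snd_prod]

theorem d2_sq (μ ν : P2 W) : d2 μ ν ^ 2 =
    (⨅ γ ∈ couplings μ.toMeasure ν.toMeasure, ∫⁻ z, ‖z.1 - z.2‖ₑ ^ (2 : ℝ) ∂γ).toReal := by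
  rw [d2, wasserstein, ← ENNReal.toReal_rpow, ← Real.rpow_natCast, ← Real.rpow_mul (by positivity)]
  norm_num

theorem d2_nonneg (μ ν : P2 W) : 0 ≤ d2 μ ν := ENNReal.toReal_nonneg

theorem P2.toMeasure_law [BorelSpace W] {Ω : Type*} [MeasurableSpace Ω] (P : Measure Ω)
    [IsProbabilityMeasure P] {Z : Ω → W} (hZ : MemLp Z 2 P) :
    (P2.law P Z hZ).toMeasure = P.map Z := rfl

theorem d1_nonneg (μ ν : P2 W) : 0 ≤ d1 μ ν := ENNReal.toReal_nonneg

theorem d1_le_of_mem_couplings {μ ν : P2 W} {γ : Measure (W × W)}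
    (hγ : γ ∈ couplings μ.toMeasure ν.toMeasure) (hi : Integrable (fun z : W × W => z.1 - z.2) γ) :
    d1 μ ν ≤ ∫ z, ‖z.1 - z.2‖ ∂γ := by
  rw [d1, wasserstein]
  simp only [ENNReal.rpow_one, ne_eq, one_ne_zero, not_false_eq_true, div_self]
  refine ENNReal.toReal_le_of_le_ofReal (integral_nonneg fun _ => norm_nonneg _) ?_
  rw [ofReal_integral_norm_eq_lintegral_enorm hi]
  exact iInf₂_le γ hγ

variable [BorelSpace W] [SecondCountableTopology W]

theorem d1_self (μ : P2 W) : d1 μ μ = 0 := by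
  have hm : Measurable fun y : W => (y, y) := measurable_id.prodMk measurable_id
  have hdiag : μ.toMeasure.map (fun y => (y, y)) ∈ couplings μ.toMeasure μ.toMeasure := by
    constructor
    · rw [Measure.map_map measurable_fst hm]; exact Measure.map_id
    · rw [Measure.map_map measurable_snd hm]; exact Measure.map_id
  refine le_antisymm ((d1_le_of_mem_couplings hdiag ?_).trans_eq ?_) (d1_nonneg μ μ)
  · rw [integrable_map_measure (Continuous.aestronglyMeasurable (by fun_prop)) hm.aemeasurable]
    simp [Function.comp_def]
  · rw [integral_map hm.aemeasurable (Continuous.aestronglyMeasurable (by fun_prop))]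
    simp

theorem P2.memLp_id (μ : P2 W) : MemLp (fun x => x) 2 μ.toMeasure := by
  refine ⟨aestronglyMeasurable_id, ?_⟩
  rw [eLpNorm_lt_top_iff_lintegral_rpow_enorm_lt_top (by norm_num) (by norm_num)]
  simpa [P2.toMeasure] using μ.2.2

theorem memLp_fst_of_mem_couplings {μ ν : P2 W} {γ : Measure (W × W)}
    (hγ : γ ∈ couplings μ.toMeasure ν.toMeasure) : MemLp (fun z => z.1) 2 γ :=
  (memLp_map_measure_iff aestronglyMeasurable_id measurable_fst.aemeasurable).1
    (hγ.1 ▸ μ.memLp_id)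

theorem memLp_snd_of_mem_couplings {μ ν : P2 W} {γ : Measure (W × W)}
    (hγ : γ ∈ couplings μ.toMeasure ν.toMeasure) : MemLp (fun z => z.2) 2 γ :=
  (memLp_map_measure_iff aestronglyMeasurable_id measurable_snd.aemeasurable).1
    (hγ.2 ▸ ν.memLp_id)

theorem lintegral_coupling {μ ν : P2 W} {γ : Measure (W × W)}
    (hγ : γ ∈ couplings μ.toMeasure ν.toMeasure) :
    ∫⁻ z, ‖z.1 - z.2‖ₑ ^ (2 : ℝ) ∂γ = ENNReal.ofReal (∫ z, ‖z.1 - z.2‖ ^ 2 ∂γ) :=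
  lintegral_enorm_rpow_two ((memLp_fst_of_mem_couplings hγ).sub (memLp_snd_of_mem_couplings hγ))

theorem d2_sq_le_of_mem_couplings {μ ν : P2 W} {γ : Measure (W × W)}
    (hγ : γ ∈ couplings μ.toMeasure ν.toMeasure) :
    d2 μ ν ^ 2 ≤ ∫ z, ‖z.1 - z.2‖ ^ 2 ∂γ := by
  rw [d2_sq]
  refine ENNReal.toReal_le_of_le_ofReal (integral_nonneg fun _ => by positivity) ?_
  rw [← lintegral_coupling hγ]
  exact iInf₂_le γ hγ

theorem le_d2_sq_of_forall_mem_couplings {μ ν : P2 W} {B : ℝ}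
    (h : ∀ γ ∈ couplings μ.toMeasure ν.toMeasure, B ≤ ∫ z, ‖z.1 - z.2‖ ^ 2 ∂γ) :
    B ≤ d2 μ ν ^ 2 := by
  rw [d2_sq]
  refine (ENNReal.ofReal_le_iff_le_toReal ?_).1 (le_iInf₂ fun γ hγ => ?_)
  · have h0 := prod_mem_couplings μ ν
    refine ne_top_of_le_ne_top ?_ (iInf₂_le _ h0)
    rw [lintegral_coupling h0]
    exact ENNReal.ofReal_ne_top
  · rw [lintegral_coupling hγ]
    exact ENNReal.ofReal_le_ofReal (h γ hγ)

theorem P2.integral_law {Ω F : Type*} [MeasurableSpace Ω] (P : Measure Ω) [IsProbabilityMeasure P]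
    [NormedAddCommGroup F] [NormedSpace ℝ F] {Z : Ω → W} (hZ : MemLp Z 2 P) {g : W → F}
    (hg : Continuous g) : ∫ y, g y ∂(P2.law P Z hZ).toMeasure = ∫ ω, g (Z ω) ∂P :=
  integral_map hZ.aestronglyMeasurable.aemeasurable hg.aestronglyMeasurable

theorem d2_law_sq_le {Ω : Type*} [MeasurableSpace Ω] (P : Measure Ω) [IsProbabilityMeasure P]
    {Z Z' : Ω → W} (hZ : MemLp Z 2 P) (hZ' : MemLp Z' 2 P) :
    d2 (P2.law P Z hZ) (P2.law P Z' hZ') ^ 2 ≤ ∫ ω, ‖Z ω - Z' ω‖ ^ 2 ∂P := by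
  have hm := hZ.aestronglyMeasurable.aemeasurable
  have hm' := hZ'.aestronglyMeasurable.aemeasurable
  have hγ : P.map (fun ω => (Z ω, Z' ω)) ∈
      couplings (P2.law P Z hZ).toMeasure (P2.law P Z' hZ').toMeasure := by
    constructor
    · rw [AEMeasurable.map_map_of_aemeasurable measurable_fst.aemeasurable (hm.prodMk hm')]
      rfl
    · rw [AEMeasurable.map_map_of_aemeasurable measurable_snd.aemeasurable (hm.prodMk hm')]
      rfl
  refine (d2_sq_le_of_mem_couplings hγ).trans_eq ?_
  rw [integral_map (hm.prodMk hm')]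
  exact Continuous.aestronglyMeasurable (by fun_prop)

/-- A Lipschitz flat derivative makes the function itself Lipschitz with respect to `d₁`, here
expressed through random variables with the given laws. -/
theorem norm_sub_law_le_of_flatDeriv {F : Type*} [NormedAddCommGroup F] [NormedSpace ℝ F]
    {f : P2 W → F} {g : P2 W → W → F} (hf : ∀ μ, HasFlatDeriv f (g μ) μ) {K : ℝ}
    (hK : ∀ μ y y', ‖g μ y - g μ y'‖ ≤ K * ‖y - y'‖)
    {Ω : Type*} [MeasurableSpace Ω] (P : Measure Ω) [IsProbabilityMeasure P]
    {Z Z' : Ω → W} (hZ : MemLp Z 2 P) (hZ' : MemLp Z' 2 P) :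
    ‖f (P2.law P Z hZ) - f (P2.law P Z' hZ')‖ ≤ K * ∫ ω, ‖Z ω - Z' ω‖ ∂P := by
  refine norm_sub_le_of_flatDeriv hf _ _ fun t => ?_
  obtain ⟨hc, hint, -⟩ := hf (P2.mix t (P2.law P Z' hZ') (P2.law P Z hZ))
  have hi : ∀ {Y : Ω → W} (_ : MemLp Y 2 P), Integrable
      (fun ω => g (P2.mix t (P2.law P Z' hZ') (P2.law P Z hZ)) (Y ω)) P := fun hY =>
    (integrable_map_measure hc.aestronglyMeasurable hY.aestronglyMeasurable.aemeasurable).1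
      (hint (P2.law P _ hY))
  rw [P2.integral_law P hZ hc, P2.integral_law P hZ' hc, ← integral_sub (hi hZ) (hi hZ'),
    ← integral_const_mul]
  exact norm_integral_le_of_norm_le
    (((hZ.sub hZ').integrable (by norm_num)).norm.const_mul K)
    (Eventually.of_forall fun ω => hK _ _ _)

end Wasserstein

/-! ### The mean field equation -/

section MeanField

variable {d : ℕ} {L : Lagrangian d}

/-- The quantitative properties of `D_a L` on which the analysis of the fixed-point equations
rests: `D_a L` is `K`-Lipschitz in `(x, a)`, it has a flat derivative that is `K`-Lipschitz in all
variables, and its lift to random variables is `c`-strongly monotone in the control, for a fixed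
state process `X`. -/
structure GradABounds (L : Lagrangian d) (c K : ℝ) : Prop where
  intro ::
  pos : 0 < c
  nonneg : 0 ≤ K
  lip : ∀ x a x' a' μ, ‖gradA L x a μ - gradA L x' a' μ‖ ≤ K * (‖x - x'‖ + ‖a - a'‖)
  flat : ∃ g : Rd d → Rd d → P2 (RdRd d) → RdRd d → Rd d,
    (∀ x a μ, HasFlatDeriv (fun μ => gradA L x a μ) (g x a μ) μ) ∧ ∀ x a μ y x' a' μ' y',
      ‖g x a μ y - g x' a' μ' y'‖ ≤ K * (‖x - x'‖ + ‖a - a'‖ + d1 μ μ' + ‖y - y'‖)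
  mono : ∀ {Ω : Type} [MeasurableSpace Ω] (P : Measure Ω) [IsProbabilityMeasure P]
    {X α α' : Ω → Rd d} (hX : MemLp X 2 P) (hα : MemLp α 2 P) (hα' : MemLp α' 2 P),
    c * ∫ ω, ‖α ω - α' ω‖ ^ 2 ∂P ≤
      ∫ ω, inner ℝ (gradA L (X ω) (α ω) (jointLaw P X α hX hα) -
        gradA L (X ω) (α' ω) (jointLaw P X α' hX hα')) (α ω - α' ω) ∂P

theorem exists_gradABounds (hL : Regular L) (hmono : WeaklyDisplacementMonotone L) :
    ∃ c K, GradABounds L c K := by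
  obtain ⟨-, ⟨K₁, hK₁, hlip⟩, -⟩ := hL.gradA_static
  obtain ⟨g, hg, K₂, hK₂⟩ := hL.flatA
  obtain ⟨c, hc, cX, -, h⟩ := hmono
  refine ⟨c, max K₁ K₂, hc, hK₁.trans (le_max_left _ _), fun x a x' a' μ => ?_,
    ⟨g, hg, fun x a μ y x' a' μ' y' => ?_⟩, fun {Ω} _ P _ X α α' hX hα hα' => ?_⟩
  · exact (hlip x a x' a' μ).trans (by gcongr; exact le_max_left _ _)
  · refine (hK₂ x a μ y x' a' μ' y').trans (mul_le_mul_of_nonneg_right (le_max_right _ _) ?_)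
    have := d1_nonneg μ μ'
    positivity
  -- for equal states the term with `D_x L` and the term with `cX` vanish
  · simpa using h Ω P X α X α' hX hα hX hα'

theorem GradABounds.lip_law {c K : ℝ} (h : GradABounds L c K) {Ω : Type*} [MeasurableSpace Ω]
    (P : Measure Ω) [IsProbabilityMeasure P] {Z Z' : Ω → RdRd d} (hZ : MemLp Z 2 P)
    (hZ' : MemLp Z' 2 P) (x a : Rd d) :
    ‖gradA L x a (P2.law P Z hZ) - gradA L x a (P2.law P Z' hZ')‖ ≤ K * ∫ ω, ‖Z ω - Z' ω‖ ∂P := by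
  obtain ⟨g, hg, hK⟩ := h.flat
  refine norm_sub_law_le_of_flatDeriv (hg x a) (K := K) (fun μ y y' => ?_) P hZ hZ'
  simpa [d1_self] using hK x a μ y x a μ y'

theorem Regular.gradPH_lipschitz (hL : Regular L) : ∃ M : ℝ, 0 ≤ M ∧ ∀ x p x' p' μ,
    ‖gradPH L x p μ - gradPH L x' p' μ‖ ≤ M * (‖x - x'‖ + ‖p - p'‖) := by
  obtain ⟨-, ⟨K, hK, hlip⟩, c, hc, hmono⟩ := hL.gradA_static
  refine ⟨(K + 1) / c, by positivity, fun x p x' p' μ => ?_⟩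
  obtain ⟨a, ha⟩ : ∃ a, a = -gradPH L x p μ := ⟨_, rfl⟩
  obtain ⟨a', ha'⟩ : ∃ a', a' = -gradPH L x' p' μ := ⟨_, rfl⟩
  have e : ‖gradPH L x p μ - gradPH L x' p' μ‖ = ‖a - a'‖ := by
    rw [ha, ha', ← neg_sub', norm_neg]
  rw [hL.eq_neg_gradPH_iff] at ha ha'
  have h1 := mul_norm_le_of_mul_sq_le_inner (hmono x μ a a')
  have h2 : gradA L x a μ - gradA L x a' μ =
      -(p - p') - (gradA L x a' μ - gradA L x' a' μ) := by rw [ha, ha']; abel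
  have h3 := hlip x a' x' a' μ
  have h4 : c * ‖a - a'‖ ≤ ‖p - p'‖ + K * ‖x - x'‖ := by
    rw [h2] at h1
    refine h1.trans ((norm_sub_le _ _).trans ?_)
    rw [norm_neg]
    simpa using h3
  rw [e, div_mul_eq_mul_div, le_div_iff₀ hc]
  nlinarith [norm_nonneg (x - x'), norm_nonneg (p - p')]

variable {Ω : Type} [MeasurableSpace Ω] {P : Measure Ω}

theorem integrable_inner_of_memLp {E : Type*} [NormedAddCommGroup E] [InnerProductSpace ℝ E]
    {u v : Ω → E} (hu : MemLp u 2 P) (hv : MemLp v 2 P) :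
    Integrable (fun ω => inner ℝ (u ω) (v ω)) P := by
  refine (L2.integrable_inner (𝕜 := ℝ) (hu.toLp u) (hv.toLp v)).congr ?_
  filter_upwards [hu.coeFn_toLp, hv.coeFn_toLp] with ω h1 h2
  rw [h1, h2]

variable [IsProbabilityMeasure P]

/-- Functions of linear growth preserve square integrability; here for functions that are Lipschitz
continuous in two variables. -/
theorem memLp_two_of_lipschitz {G : Rd d → Rd d → Rd d} {K : ℝ}
    (hK0 : 0 ≤ K) (hG : ∀ x a x' a', ‖G x a - G x' a'‖ ≤ K * (‖x - x'‖ + ‖a - a'‖))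
    {X α : Ω → Rd d} (hX : MemLp X 2 P) (hα : MemLp α 2 P) :
    MemLp (fun ω => G (X ω) (α ω)) 2 P := by
  have hc : Continuous fun q : Rd d × Rd d => G q.1 q.2 := by
    refine (LipschitzWith.of_dist_le' (K := 2 * K) fun q q' => ?_).continuous
    rw [dist_eq_norm, dist_eq_norm]
    refine (hG _ _ _ _).trans ?_
    have h1 := norm_fst_le (q - q')
    have h2 := norm_snd_le (q - q')
    simp only [Prod.fst_sub, Prod.snd_sub] at h1 h2
    nlinarith
  have hm : AEStronglyMeasurable (fun ω => G (X ω) (α ω)) P :=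
    hc.comp_aestronglyMeasurable (hX.aestronglyMeasurable.prodMk hα.aestronglyMeasurable)
  have hb : MemLp (fun ω => ‖G 0 0‖ + K * (‖X ω‖ + ‖α ω‖)) 2 P :=
    have h1 : MemLp (fun ω => ‖X ω‖ + ‖α ω‖) 2 P := hX.norm.add hα.norm
    (memLp_const ‖G 0 0‖).add (h1.const_mul K)
  refine hb.of_le hm (Eventually.of_forall fun ω => ?_)
  rw [Real.norm_of_nonneg (by positivity)]
  have := hG (X ω) (α ω) 0 0
  rw [sub_zero, sub_zero] at this
  linarith [norm_le_insert' (G (X ω) (α ω)) (G 0 0)]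

theorem GradABounds.memLp {c K : ℝ} (h : GradABounds L c K) {X α : Ω → Rd d} (hX : MemLp X 2 P)
    (hα : MemLp α 2 P) (μ : P2 (RdRd d)) : MemLp (fun ω => gradA L (X ω) (α ω) μ) 2 P :=
  memLp_two_of_lipschitz (G := fun x a => gradA L x a μ) h.nonneg
    (fun x a x' a' => h.lip x a x' a' μ) hX hα

theorem Regular.memLp_gradPH (hL : Regular L) {X p : Ω → Rd d} (hX : MemLp X 2 P)
    (hp : MemLp p 2 P) (μ : P2 (RdRd d)) : MemLp (fun ω => -gradPH L (X ω) (p ω) μ) 2 P := by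
  obtain ⟨M, hM0, hM⟩ := hL.gradPH_lipschitz
  exact (memLp_two_of_lipschitz (G := fun x p => gradPH L x p μ) hM0
    (fun x a x' a' => hM x a x' a' μ) hX hp).neg

/-- Stability of the equation `D_a L(X, α, law(X, α)) = -p` with respect to the data `X` and `p`. -/
theorem GradABounds.stability {c K : ℝ} (h : GradABounds L c K) {X α p X' α' p' : Ω → Rd d}
    (hX : MemLp X 2 P) (hα : MemLp α 2 P) (hp : MemLp p 2 P)
    (hX' : MemLp X' 2 P) (hα' : MemLp α' 2 P) (hp' : MemLp p' 2 P)
    (e : ∀ᵐ ω ∂P, gradA L (X ω) (α ω) (jointLaw P X α hX hα) = -p ω)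
    (e' : ∀ᵐ ω ∂P, gradA L (X' ω) (α' ω) (jointLaw P X' α' hX' hα') = -p' ω) :
    c ^ 2 * ∫ ω, ‖α ω - α' ω‖ ^ 2 ∂P ≤
      3 * ∫ ω, ‖p ω - p' ω‖ ^ 2 ∂P + 6 * K ^ 2 * ∫ ω, ‖X ω - X' ω‖ ^ 2 ∂P := by
  have hc := h.pos
  have hK := h.nonneg
  obtain ⟨D, hD⟩ : ∃ D, D = ∫ ω, ‖X ω - X' ω‖ ∂P := ⟨_, rfl⟩
  have hD0 : 0 ≤ D := hD ▸ integral_nonneg fun _ => norm_nonneg _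
  have hD2 : D ^ 2 ≤ ∫ ω, ‖X ω - X' ω‖ ^ 2 ∂P := hD ▸ sq_integral_norm_le (hX.sub hX')
  have hlaw : ∀ x a, ‖gradA L x a (jointLaw P X' α' hX' hα') -
      gradA L x a (jointLaw P X α' hX hα')‖ ≤ K * D := fun x a => by
    refine (h.lip_law P _ _ x a).trans (mul_le_mul_of_nonneg_left (le_of_eq ?_) hK)
    rw [hD]
    refine integral_congr_ae (Eventually.of_forall fun ω => ?_)
    exact (norm_mk_sub_mk_left _ _ _).trans (norm_sub_rev _ _)
  have iα : Integrable (fun ω => ‖α ω - α' ω‖ ^ 2) P :=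
    (hα.sub hα').integrable_norm_pow two_ne_zero
  have ip : Integrable (fun ω => ‖p ω - p' ω‖ ^ 2) P :=
    (hp.sub hp').integrable_norm_pow two_ne_zero
  have iX : Integrable (fun ω => K ^ 2 * ‖X ω - X' ω‖ ^ 2) P :=
    ((hX.sub hX').integrable_norm_pow two_ne_zero).const_mul _
  have ipX : Integrable (fun ω => ‖p ω - p' ω‖ ^ 2 + K ^ 2 * ‖X ω - X' ω‖ ^ 2) P := ip.add iX
  have iB : Integrable (fun ω => (2 * c)⁻¹ * (3 * (‖p ω - p' ω‖ ^ 2 +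
      K ^ 2 * ‖X ω - X' ω‖ ^ 2 + K ^ 2 * D ^ 2))) P :=
    ((ipX.add (integrable_const _)).const_mul _).const_mul _
  have hint : ∫ ω, inner ℝ (gradA L (X ω) (α ω) (jointLaw P X α hX hα) -
        gradA L (X ω) (α' ω) (jointLaw P X α' hX hα')) (α ω - α' ω) ∂P ≤
      ∫ ω, ((c / 2) * ‖α ω - α' ω‖ ^ 2 + (2 * c)⁻¹ * (3 * (‖p ω - p' ω‖ ^ 2 +
        K ^ 2 * ‖X ω - X' ω‖ ^ 2 + K ^ 2 * D ^ 2))) ∂P := by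
    refine integral_mono_ae
      (integrable_inner_of_memLp ((h.memLp hX hα _).sub (h.memLp hX hα' _)) (hα.sub hα'))
      ((iα.const_mul _).add iB) ?_
    filter_upwards [e, e'] with ω h1 h2
    refine (real_inner_le_norm _ _).trans ?_
    have h3 : ‖gradA L (X ω) (α ω) (jointLaw P X α hX hα) -
        gradA L (X ω) (α' ω) (jointLaw P X α' hX hα')‖ ≤
        ‖p ω - p' ω‖ + K * ‖X ω - X' ω‖ + K * D := by
      have e3 : gradA L (X ω) (α ω) (jointLaw P X α hX hα) -
          gradA L (X ω) (α' ω) (jointLaw P X α' hX hα') =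
          -(p ω - p' ω) - (gradA L (X ω) (α' ω) (jointLaw P X' α' hX' hα') -
            gradA L (X' ω) (α' ω) (jointLaw P X' α' hX' hα')) +
          (gradA L (X ω) (α' ω) (jointLaw P X' α' hX' hα') -
            gradA L (X ω) (α' ω) (jointLaw P X α' hX hα')) := by
        rw [h1, h2]; abel
      rw [e3]
      have h4 := h.lip (X ω) (α' ω) (X' ω) (α' ω) (jointLaw P X' α' hX' hα')
      rw [sub_self, norm_zero, add_zero] at h4
      refine (norm_add_le _ _).trans (add_le_add ((norm_sub_le _ _).trans ?_) (hlaw _ _))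
      rw [norm_neg]
      exact add_le_add le_rfl h4
    obtain ⟨A, hA⟩ : ∃ A, A = ‖α ω - α' ω‖ := ⟨_, rfl⟩
    obtain ⟨B, hB⟩ : ∃ B, B = ‖p ω - p' ω‖ := ⟨_, rfl⟩
    obtain ⟨Y, hY⟩ : ∃ Y, Y = ‖X ω - X' ω‖ := ⟨_, rfl⟩
    simp only [← hA, ← hB, ← hY] at h3 ⊢
    have hA0 : 0 ≤ A := hA ▸ norm_nonneg _
    have h5 : (B + K * Y + K * D) * A ≤ c / 2 * A ^ 2 + (2 * c)⁻¹ * (B + K * Y + K * D) ^ 2 := by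
      have : c / 2 * A ^ 2 + (2 * c)⁻¹ * (B + K * Y + K * D) ^ 2 - (B + K * Y + K * D) * A =
          (2 * c)⁻¹ * (c * A - (B + K * Y + K * D)) ^ 2 := by field_simp; ring
      have : 0 ≤ (2 * c)⁻¹ * (c * A - (B + K * Y + K * D)) ^ 2 := by positivity
      linarith
    have h6 : (B + K * Y + K * D) ^ 2 ≤ 3 * (B ^ 2 + K ^ 2 * Y ^ 2 + K ^ 2 * D ^ 2) := by
      nlinarith [sq_nonneg (B - K * Y), sq_nonneg (B - K * D), sq_nonneg (K * Y - K * D)]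
    calc _ ≤ (B + K * Y + K * D) * A := mul_le_mul_of_nonneg_right h3 hA0
      _ ≤ _ := h5
      _ ≤ _ := by gcongr
  have hm := (h.mono P hX hα hα').trans hint
  rw [integral_add (iα.const_mul _) iB, integral_const_mul, integral_const_mul,
    integral_const_mul, integral_add ipX (integrable_const _), integral_add ip iX,
    integral_const_mul, integral_const, probReal_univ, one_smul] at hm
  obtain ⟨A, hA⟩ : ∃ A, A = ∫ ω, ‖α ω - α' ω‖ ^ 2 ∂P := ⟨_, rfl⟩
  obtain ⟨B, hB⟩ : ∃ B, B = ∫ ω, ‖p ω - p' ω‖ ^ 2 ∂P := ⟨_, rfl⟩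
  obtain ⟨Y, hY⟩ : ∃ Y, Y = ∫ ω, ‖X ω - X' ω‖ ^ 2 ∂P := ⟨_, rfl⟩
  simp only [← hA, ← hB, ← hY] at hm hD2 ⊢
  have h7 : c * A ≤ c / 2 * A + (2 * c)⁻¹ * (3 * (B + K ^ 2 * Y + K ^ 2 * Y)) :=
    hm.trans (by gcongr)
  have h8 : 2 * c * ((2 * c)⁻¹ * (3 * (B + K ^ 2 * Y + K ^ 2 * Y))) =
      3 * (B + K ^ 2 * Y + K ^ 2 * Y) := by field_simp
  have h9 := mul_le_mul_of_nonneg_left h7 (by positivity : 0 ≤ 2 * c)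
  rw [mul_add, h8] at h9
  linarith

/-- Solvability of the equation `D_a L(X, α, law(X, α)) = -p` in the space of square-integrable
random variables `α`. -/
theorem GradABounds.exists_solution {c K : ℝ} (h : GradABounds L c K) {X p : Ω → Rd d}
    (hX : MemLp X 2 P) (hp : MemLp p 2 P) :
    ∃ (α : Ω → Rd d) (hα : MemLp α 2 P),
      ∀ᵐ ω ∂P, gradA L (X ω) (α ω) (jointLaw P X α hX hα) = -p ω := by
  have hK := h.nonneg
  have hsq : ∀ u : Lp (Rd d) 2 P, ‖u‖ ^ 2 = ∫ ω, ‖u ω‖ ^ 2 ∂P := fun u => by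
    rw [← real_inner_self_eq_norm_sq, L2.inner_def]
    simp
  have hmem : ∀ α : Lp (Rd d) 2 P, MemLp
      (fun ω => gradA L (X ω) (α ω) (jointLaw P X α hX (Lp.memLp α))) 2 P := fun α =>
    h.memLp hX (Lp.memLp α) _
  have hFmono : ∀ α β : Lp (Rd d) 2 P, c * ‖α - β‖ ^ 2 ≤
      inner ℝ ((hmem α).toLp _ - (hmem β).toLp _) (α - β) := fun α β => by
    rw [hsq, L2.inner_def]
    have h1 := h.mono P hX (Lp.memLp α) (Lp.memLp β)
    convert h1 using 1
    · congr 1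
      refine integral_congr_ae ?_
      filter_upwards [Lp.coeFn_sub α β] with ω h2
      rw [h2, Pi.sub_apply]
    · refine integral_congr_ae ?_
      filter_upwards [Lp.coeFn_sub α β, Lp.coeFn_sub ((hmem α).toLp _) ((hmem β).toLp _),
        (hmem α).coeFn_toLp, (hmem β).coeFn_toLp] with ω h2 h3 h4 h5
      rw [h2, h3, Pi.sub_apply, Pi.sub_apply, h4, h5]
  have hFlip : ∀ α β : Lp (Rd d) 2 P, ‖(hmem α).toLp _ - (hmem β).toLp _‖ ≤
      2 * K * ‖α - β‖ := fun α β => by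
    refine abs_le_of_sq_le_sq' ?_ (by positivity) |>.2
    have hαβ := (Lp.memLp α).sub (Lp.memLp β)
    have iαβ : Integrable (fun ω => ‖α ω - β ω‖ ^ 2) P := hαβ.integrable_norm_pow two_ne_zero
    have e1 : ‖α - β‖ ^ 2 = ∫ ω, ‖α ω - β ω‖ ^ 2 ∂P := by
      rw [hsq]
      refine integral_congr_ae ?_
      filter_upwards [Lp.coeFn_sub α β] with ω h2
      rw [h2, Pi.sub_apply]
    obtain ⟨D, hD⟩ : ∃ D, D = ∫ ω, ‖α ω - β ω‖ ∂P := ⟨_, rfl⟩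
    have hD2 : D ^ 2 ≤ ‖α - β‖ ^ 2 := by rw [e1, hD]; exact sq_integral_norm_le hαβ
    rw [hsq]
    have hpt : ∀ᵐ ω ∂P, ‖((hmem α).toLp _ - (hmem β).toLp _ : Lp (Rd d) 2 P) ω‖ ^ 2 ≤
        2 * K ^ 2 * ‖α ω - β ω‖ ^ 2 + 2 * K ^ 2 * D ^ 2 := by
      filter_upwards [Lp.coeFn_sub ((hmem α).toLp _) ((hmem β).toLp _),
        (hmem α).coeFn_toLp, (hmem β).coeFn_toLp] with ω h3 h4 h5
      rw [h3, Pi.sub_apply, h4, h5]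
      have h6 := h.lip (X ω) (α ω) (X ω) (β ω) (jointLaw P X α hX (Lp.memLp α))
      rw [sub_self, norm_zero, zero_add] at h6
      have h7 : ‖gradA L (X ω) (β ω) (jointLaw P X α hX (Lp.memLp α)) -
          gradA L (X ω) (β ω) (jointLaw P X β hX (Lp.memLp β))‖ ≤ K * D := by
        refine (h.lip_law P _ _ _ _).trans (mul_le_mul_of_nonneg_left (le_of_eq ?_) hK)
        rw [hD]
        refine integral_congr_ae (Eventually.of_forall fun ω => ?_)
        exact norm_mk_sub_mk_right _ _ _
      have h8 := (norm_sub_le_norm_sub_add_norm_sub _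
        (gradA L (X ω) (β ω) (jointLaw P X α hX (Lp.memLp α))) _).trans (add_le_add h6 h7)
      calc _ ≤ (K * ‖α ω - β ω‖ + K * D) ^ 2 := pow_le_pow_left₀ (norm_nonneg _) h8 2
        _ ≤ _ := by nlinarith [sq_nonneg (K * ‖α ω - β ω‖ - K * D)]
    have h9 := integral_mono_ae ((Lp.memLp _).integrable_norm_pow two_ne_zero)
      ((iαβ.const_mul (2 * K ^ 2)).add (integrable_const (2 * K ^ 2 * D ^ 2))) hpt
    simp only [Pi.add_apply] at h9
    rw [integral_add (iαβ.const_mul (2 * K ^ 2)) (integrable_const _), integral_const_mul,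
      integral_const, probReal_univ, one_smul, ← e1] at h9
    refine h9.trans ?_
    nlinarith [mul_le_mul_of_nonneg_left hD2 (sq_nonneg K)]
  obtain ⟨α, hα⟩ := exists_eq_of_stronglyMonotone h.pos hFmono hFlip (-hp.toLp p)
  refine ⟨α, Lp.memLp α, ?_⟩
  have h1 := (hmem α).coeFn_toLp
  rw [hα] at h1
  filter_upwards [h1, Lp.coeFn_neg (hp.toLp p), hp.coeFn_toLp] with ω h1 h2 h3
  rw [← h1, h2, Pi.neg_apply, h3]

end MeanField

section MeanFieldMap

variable {d : ℕ} {L : Lagrangian d}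

theorem P2.memLp_fst_snd (ν : P2 (RdRd d)) :
    MemLp (fun z : RdRd d => z.fst) 2 ν.toMeasure ∧ MemLp (fun z : RdRd d => z.snd) 2 ν.toMeasure :=
  memLp_prodLp_iff.1 ν.memLp_id

/-- A solution `μ` of the mean field equation, seen on any probability space that carries random
variables `(X, p)` with law `ν`. -/
theorem IsMeanFieldFixedPoint.jointLaw_eq (hL : Regular L) {ν μ : P2 (RdRd d)}
    (hμ : IsMeanFieldFixedPoint L ν μ) {Ω : Type} [MeasurableSpace Ω] {P : Measure Ω}
    [IsProbabilityMeasure P] {X p : Ω → Rd d} (hX : MemLp X 2 P) (hp : MemLp p 2 P)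
    (hν : jointLaw P X p hX hp = ν) :
    jointLaw P X (fun ω => -gradPH L (X ω) (p ω) μ) hX (hL.memLp_gradPH hX hp μ) = μ := by
  refine P2.ext ?_
  have hm : AEMeasurable (fun z : RdRd d => mk z.fst (-gradPH L z.fst z.snd μ)) ν.toMeasure :=
    (memLp_prodLp_iff.2 ⟨ν.memLp_fst_snd.1, hL.memLp_gradPH ν.memLp_fst_snd.1
      ν.memLp_fst_snd.2 μ⟩ : MemLp (fun z : RdRd d => mk z.fst (-gradPH L z.fst z.snd μ)) 2
        ν.toMeasure).aestronglyMeasurable.aemeasurable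
  have hXp : AEMeasurable (fun ω => mk (X ω) (p ω)) P :=
    (memLp_prodLp_iff.2 ⟨hX, hp⟩ : MemLp (fun ω => mk (X ω) (p ω)) 2
      P).aestronglyMeasurable.aemeasurable
  rw [← show _ = μ.toMeasure from hμ]
  subst hν
  exact (AEMeasurable.map_map_of_aemeasurable hm hXp).symm

theorem exists_isMeanFieldFixedPoint (hL : Regular L) {c K : ℝ} (h : GradABounds L c K)
    (ν : P2 (RdRd d)) : ∃ μ, IsMeanFieldFixedPoint L ν μ := by
  obtain ⟨hX, hp⟩ := ν.memLp_fst_snd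
  obtain ⟨α, hα, e⟩ := h.exists_solution hX hp
  refine ⟨jointLaw ν.toMeasure _ α hX hα, Measure.map_congr ?_⟩
  filter_upwards [e] with z hz
  rw [← (hL.eq_neg_gradPH_iff _ _ _ _).2 hz]

theorem IsMeanFieldFixedPoint.unique (hL : Regular L) {c K : ℝ} (h : GradABounds L c K)
    {ν μ μ' : P2 (RdRd d)} (hμ : IsMeanFieldFixedPoint L ν μ)
    (hμ' : IsMeanFieldFixedPoint L ν μ') : μ = μ' := by
  obtain ⟨hX, hp⟩ := ν.memLp_fst_snd
  have e := hμ.jointLaw_eq hL hX hp (P2.ext Measure.map_id)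
  have e' := hμ'.jointLaw_eq hL hX hp (P2.ext Measure.map_id)
  have hα := hL.memLp_gradPH hX hp μ
  have hα' := hL.memLp_gradPH hX hp μ'
  have hst := h.stability hX hα hp hX hα' hp
    (Eventually.of_forall fun z => by rw [e]; exact (hL.eq_neg_gradPH_iff _ _ _ _).1 rfl)
    (Eventually.of_forall fun z => by rw [e']; exact (hL.eq_neg_gradPH_iff _ _ _ _).1 rfl)
  simp only [sub_self, norm_zero, ne_eq, OfNat.ofNat_ne_zero, not_false_eq_true, zero_pow,
    integral_zero, mul_zero, add_zero] at hst
  have hc := h.pos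
  have h0 : ∫ z, ‖-gradPH L z.fst z.snd μ - -gradPH L z.fst z.snd μ'‖ ^ 2 ∂ν.toMeasure = 0 :=
    le_antisymm (nonpos_of_mul_nonpos_right hst (by positivity))
      (integral_nonneg fun _ => by positivity)
  have iα : Integrable (fun z : RdRd d => ‖-gradPH L z.fst z.snd μ -
      -gradPH L z.fst z.snd μ'‖ ^ 2) ν.toMeasure :=
    (hα.sub hα').integrable_norm_pow two_ne_zero
  rw [integral_eq_zero_iff_of_nonneg (fun _ => by positivity) iα] at h0
  rw [← e, ← e']
  refine P2.ext (Measure.map_congr ?_)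
  filter_upwards [h0] with z hz
  have hz' : -gradPH L z.fst z.snd μ = -gradPH L z.fst z.snd μ' := by
    rw [← sub_eq_zero, ← norm_eq_zero]
    exact pow_eq_zero_iff two_ne_zero |>.1 hz
  rw [hz']

theorem IsMeanFieldFixedPoint.d2_le (hL : Regular L) {c K : ℝ} (h : GradABounds L c K)
    {ν μ ν' μ' : P2 (RdRd d)} (hμ : IsMeanFieldFixedPoint L ν μ)
    (hμ' : IsMeanFieldFixedPoint L ν' μ') :
    d2 μ μ' ≤ √(1 + (3 + 6 * K ^ 2) / c ^ 2) * d2 ν ν' := by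
  have hc := h.pos
  obtain ⟨M, hM⟩ : ∃ M, M = 1 + (3 + 6 * K ^ 2) / c ^ 2 := ⟨_, rfl⟩
  have hM0 : 0 < M := by rw [hM]; positivity
  rw [← hM]
  have key : M⁻¹ * d2 μ μ' ^ 2 ≤ d2 ν ν' ^ 2 := by
    refine le_d2_sq_of_forall_mem_couplings fun γ hγ => ?_
    have := isProbabilityMeasure_of_mem_couplings hγ
    obtain ⟨hX, hp⟩ := memLp_prodLp_iff.1 (memLp_fst_of_mem_couplings hγ)
    obtain ⟨hX', hp'⟩ := memLp_prodLp_iff.1 (memLp_snd_of_mem_couplings hγ)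
    have hα := hL.memLp_gradPH hX hp μ
    have hα' := hL.memLp_gradPH hX' hp' μ'
    have e := hμ.jointLaw_eq hL hX hp (P2.ext hγ.1)
    have e' := hμ'.jointLaw_eq hL hX' hp' (P2.ext hγ.2)
    have hst := h.stability hX hα hp hX' hα' hp'
      (Eventually.of_forall fun z => by rw [e]; exact (hL.eq_neg_gradPH_iff _ _ _ _).1 rfl)
      (Eventually.of_forall fun z => by rw [e']; exact (hL.eq_neg_gradPH_iff _ _ _ _).1 rfl)
    have hd := d2_law_sq_le γ (memLp_prodLp_iff.2 ⟨hX, hα⟩ : MemLp (fun z : RdRd d × RdRd d =>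
        mk z.1.fst (-gradPH L z.1.fst z.1.snd μ)) 2 γ)
      (memLp_prodLp_iff.2 ⟨hX', hα'⟩ : MemLp (fun z : RdRd d × RdRd d =>
        mk z.2.fst (-gradPH L z.2.fst z.2.snd μ')) 2 γ)
    change d2 (jointLaw γ _ _ hX hα) (jointLaw γ _ _ hX' hα') ^ 2 ≤ _ at hd
    rw [e, e'] at hd
    have iX : Integrable (fun z : RdRd d × RdRd d => ‖z.1.fst - z.2.fst‖ ^ 2) γ :=
      (hX.sub hX').integrable_norm_pow two_ne_zero
    have ip : Integrable (fun z : RdRd d × RdRd d => ‖z.1.snd - z.2.snd‖ ^ 2) γ :=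
      (hp.sub hp').integrable_norm_pow two_ne_zero
    have iα : Integrable (fun z : RdRd d × RdRd d => ‖-gradPH L z.1.fst z.1.snd μ -
        -gradPH L z.2.fst z.2.snd μ'‖ ^ 2) γ :=
      (hα.sub hα').integrable_norm_pow two_ne_zero
    simp only [mk_sub_mk, norm_mk_sq] at hd
    rw [integral_add iX iα] at hd
    have hz : ∫ z : RdRd d × RdRd d, ‖z.1 - z.2‖ ^ 2 ∂γ = ∫ z : RdRd d × RdRd d,
        (‖z.1.fst - z.2.fst‖ ^ 2 + ‖z.1.snd - z.2.snd‖ ^ 2) ∂γ :=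
      integral_congr_ae (Eventually.of_forall fun z => WithLp.prod_norm_sq_eq_of_L2 _)
    rw [hz, integral_add iX ip, inv_mul_le_iff₀ hM0]
    have hX0 : 0 ≤ ∫ z : RdRd d × RdRd d, ‖z.1.fst - z.2.fst‖ ^ 2 ∂γ :=
      integral_nonneg fun _ => by positivity
    have hp0 : 0 ≤ ∫ z : RdRd d × RdRd d, ‖z.1.snd - z.2.snd‖ ^ 2 ∂γ :=
      integral_nonneg fun _ => by positivity
    rw [← le_div_iff₀' (by positivity)] at hst
    refine hd.trans ((add_le_add le_rfl hst).trans ?_)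
    generalize ∫ z : RdRd d × RdRd d, ‖z.1.fst - z.2.fst‖ ^ 2 ∂γ = A at *
    generalize ∫ z : RdRd d × RdRd d, ‖z.1.snd - z.2.snd‖ ^ 2 ∂γ = B at *
    have e1 : M * (A + B) - (A + (3 * B + 6 * K ^ 2 * A) / c ^ 2) =
        B + (3 * A + 6 * K ^ 2 * B) / c ^ 2 := by rw [hM]; ring
    have e2 : 0 ≤ B + (3 * A + 6 * K ^ 2 * B) / c ^ 2 := by positivity
    linarith
  refine abs_le_of_sq_le_sq' ?_ (mul_nonneg (Real.sqrt_nonneg _) (d2_nonneg _ _)) |>.2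
  rwa [mul_pow, Real.sq_sqrt hM0.le, ← inv_mul_le_iff₀ hM0]

end MeanFieldMap

/-! ### Empirical measures -/

section Empirical

/-- The normalized sum of the Dirac masses at the points `z j`, `j ∈ s`, as a mere measure. -/
def uniformSum {S ι : Type*} [MeasurableSpace S] (s : Finset ι) (z : ι → S) : Measure S :=
  (s.card : ℝ≥0∞)⁻¹ • ∑ j ∈ s, Measure.dirac (z j)

section UniformSum

variable {S T ι F : Type*} [MeasurableSpace S] [MeasurableSpace T] [NormedAddCommGroup F]
  {s : Finset ι} {z : ι → S}

theorem isProbabilityMeasure_uniformSum (hs : s.Nonempty) :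
    IsProbabilityMeasure (uniformSum s z) := by
  have h0 : (s.card : ℝ≥0∞) ≠ 0 := by simpa using hs.ne_empty
  exact ⟨by simp [uniformSum, ENNReal.inv_mul_cancel h0 (ENNReal.natCast_ne_top _)]⟩

theorem map_uniformSum {f : S → T} (hf : Measurable f) :
    (uniformSum s z).map f = uniformSum s (fun j => f (z j)) := by
  rw [uniformSum, uniformSum, Measure.map_smul, Measure.map_finset_sum hf.aemeasurable]
  simp [Measure.map_dirac' hf]

theorem integrable_uniformSum [MeasurableSingletonClass S] (hs : s.Nonempty) (g : S → F) :
    Integrable g (uniformSum s z) := by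
  refine Integrable.smul_measure (integrable_finsetSum_measure.2 fun j _ =>
    integrable_dirac enorm_lt_top) (ENNReal.inv_ne_top.2 (by simpa using hs.ne_empty))

theorem integral_uniformSum [NormedSpace ℝ F] [CompleteSpace F] [MeasurableSingletonClass S]
    (g : S → F) : ∫ y, g y ∂uniformSum s z = (s.card : ℝ)⁻¹ • ∑ j ∈ s, g (z j) := by
  rw [uniformSum, integral_smul_measure, integral_finsetSum_measure fun j _ =>
    integrable_dirac enorm_lt_top]
  simp

end UniformSum

theorem mix_mem_couplings {W : Type*} [NormedAddCommGroup W] [MeasurableSpace W]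
    {μ ν μ' ν' : P2 W} {γ γ' : Measure (W × W)}
    (h : γ ∈ couplings μ.toMeasure μ'.toMeasure) (h' : γ' ∈ couplings ν.toMeasure ν'.toMeasure)
    (t : I) : ENNReal.ofReal (1 - t) • γ + ENNReal.ofReal t • γ' ∈
      couplings (P2.mix t μ ν).toMeasure (P2.mix t μ' ν').toMeasure := by
  rw [P2.toMeasure_mix, P2.toMeasure_mix]
  constructor
  · rw [Measure.map_add _ _ measurable_fst, Measure.map_smul, Measure.map_smul, h.1, h'.1]
  · rw [Measure.map_add _ _ measurable_snd, Measure.map_smul, Measure.map_smul, h.2, h'.2]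

variable {W ι : Type*} [NormedAddCommGroup W] [MeasurableSpace W] [MeasurableSingletonClass W]
  {s : Finset ι} {z : ι → W}

theorem P2.toMeasure_empirical (hs : s.Nonempty) :
    (P2.empirical s z).toMeasure = uniformSum s z := by
  simp [P2.empirical, hs, P2.toMeasure, uniformSum]

theorem uniformSum_mem_couplings (hs : s.Nonempty) (z z' : ι → W) :
    uniformSum s (fun j => (z j, z' j)) ∈
      couplings (P2.empirical s z).toMeasure (P2.empirical s z').toMeasure := by
  rw [P2.toMeasure_empirical hs, P2.toMeasure_empirical hs]
  exact ⟨map_uniformSum measurable_fst, map_uniformSum measurable_snd⟩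

theorem d1_mix_empirical_le [BorelSpace W] [SecondCountableTopology W] {s s' : Finset ι}
    (hs : s.Nonempty) (hs' : s'.Nonempty) (z z' : ι → W) {B : ℝ}
    (h : (s.card : ℝ)⁻¹ * ∑ j ∈ s, ‖z j - z' j‖ ≤ B)
    (h' : (s'.card : ℝ)⁻¹ * ∑ j ∈ s', ‖z j - z' j‖ ≤ B) (t : I) :
    d1 (P2.mix t (P2.empirical s z) (P2.empirical s' z))
      (P2.mix t (P2.empirical s z') (P2.empirical s' z')) ≤ B := by
  have hi := (integrable_uniformSum (z := fun j => (z j, z' j)) hs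
    (fun w : W × W => w.1 - w.2)).smul_measure (c := ENNReal.ofReal (1 - t)) ENNReal.ofReal_ne_top
  have hi' := (integrable_uniformSum (z := fun j => (z j, z' j)) hs'
    (fun w : W × W => w.1 - w.2)).smul_measure (c := ENNReal.ofReal t) ENNReal.ofReal_ne_top
  refine (d1_le_of_mem_couplings (mix_mem_couplings (uniformSum_mem_couplings hs z z')
    (uniformSum_mem_couplings hs' z z') t) (hi.add_measure hi')).trans ?_
  rw [integral_add_measure hi.norm hi'.norm, integral_smul_measure, integral_smul_measure,
    integral_uniformSum, integral_uniformSum, ENNReal.toReal_ofReal (by linarith [t.2.2]),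
    ENNReal.toReal_ofReal t.2.1]
  simp only [smul_eq_mul]
  nlinarith [mul_le_mul_of_nonneg_left h (by linarith [t.2.2] : 0 ≤ 1 - (t : ℝ)),
    mul_le_mul_of_nonneg_left h' t.2.1]

/-- Leaving out the point `z i` changes the empirical average of `g` only at order `1 / N`, and the
change depends on differences of values of `g` only. -/
theorem integral_empirical_erase_sub {F : Type*} [NormedAddCommGroup F] [NormedSpace ℝ F]
    [CompleteSpace F] {N : ℕ} (hN : 2 ≤ N) (i : Fin N) (z : Fin N → W) (g : W → F) :
    ∫ y, g y ∂(P2.empirical (Finset.univ.erase i) z).toMeasure -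
      ∫ y, g y ∂(P2.empirical Finset.univ z).toMeasure =
    ((N : ℝ) * (N - 1))⁻¹ • ∑ j ∈ Finset.univ.erase i, (g (z j) - g (z i)) := by
  have hN' : (2 : ℝ) ≤ N := by exact_mod_cast hN
  have hcard : (Finset.univ.erase i).card = N - 1 := by
    rw [Finset.card_erase_of_mem (Finset.mem_univ i), Finset.card_univ, Fintype.card_fin]
  have hne : (Finset.univ.erase i).Nonempty := Finset.card_pos.1 (by omega)
  rw [P2.toMeasure_empirical hne, P2.toMeasure_empirical ⟨i, Finset.mem_univ i⟩,
    integral_uniformSum, integral_uniformSum, hcard, Finset.card_univ, Fintype.card_fin,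
    ← Finset.add_sum_erase _ _ (Finset.mem_univ i), Finset.sum_sub_distrib, Finset.sum_const,
    hcard, ← Nat.cast_smul_eq_nsmul ℝ, Nat.cast_sub (by omega), Nat.cast_one]
  have h1 : (N : ℝ) ≠ 0 := by linarith
  have h2 : (N : ℝ) - 1 ≠ 0 := by linarith
  match_scalars <;> field_simp
  ring

theorem P2.law_uniformSum [BorelSpace W] {N : ℕ} (s : Finset (Fin N)) (hs : s.Nonempty)
    [IsProbabilityMeasure (uniformSum s (id : Fin N → Fin N))] (z : Fin N → W)
    (hz : MemLp z 2 (uniformSum s id)) : P2.law (uniformSum s id) z hz = P2.empirical s z := by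
  refine P2.ext ?_
  rw [P2.toMeasure_law, P2.toMeasure_empirical hs, map_uniformSum .of_discrete]
  rfl

end Empirical

/-! ### The `N`-player equations -/

section Players

variable {d : ℕ} {L : Lagrangian d} {c K : ℝ} {N : ℕ}

/-- A family of `N` vectors of `ℝ^d`, as a point of the Euclidean space `(ℝ^d)^N`. -/
abbrev vec (f : Fin N → Rd d) : PiLp 2 fun _ : Fin N => Rd d := WithLp.toLp 2 f

theorem norm_vec_sq (f : Fin N → Rd d) : ‖vec f‖ ^ 2 = ∑ i, ‖f i‖ ^ 2 :=
  PiLp.norm_sq_eq_of_L2 _ _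

theorem vec_sub_vec (f g : Fin N → Rd d) : vec f - vec g = vec (f - g) := rfl

/-- The form in which all interaction terms are estimated: a bound of the `i`-th component by `u i`
and by (twice) the average of `u` yields a bound of the Euclidean norm that is uniform in `N`. -/
theorem norm_vec_sq_le_of_average (hN : 2 ≤ N) {f : Fin N → Rd d} {u : Fin N → ℝ} {M : ℝ}
    (h : ∀ i, ‖f i‖ ≤ M * (u i + 2 / N * ∑ j, u j)) :
    ‖vec f‖ ^ 2 ≤ 10 * M ^ 2 * ∑ i, u i ^ 2 := by
  have hN0 : (0 : ℝ) < N := by exact_mod_cast (by omega : 0 < N)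
  obtain ⟨S, hS⟩ : ∃ S, S = ∑ j, u j := ⟨_, rfl⟩
  have hcs : S ^ 2 ≤ N * ∑ i, u i ^ 2 := by
    have := sq_sum_le_card_mul_sum_sq (s := (Finset.univ : Finset (Fin N))) (f := u)
    rwa [Finset.card_univ, Fintype.card_fin, ← hS] at this
  rw [norm_vec_sq]
  calc ∑ i, ‖f i‖ ^ 2 ≤ ∑ i, M ^ 2 * (2 * u i ^ 2 + 8 / N ^ 2 * S ^ 2) := by
        refine Finset.sum_le_sum fun i _ => ?_
        refine (pow_le_pow_left₀ (norm_nonneg _) (h i) 2).trans ?_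
        rw [← hS, mul_pow]
        refine mul_le_mul_of_nonneg_left ?_ (sq_nonneg M)
        have e : 8 / (N : ℝ) ^ 2 * S ^ 2 = 2 * (2 / N * S) ^ 2 := by ring
        rw [e]
        nlinarith [sq_nonneg (u i - 2 / N * S)]
    _ = M ^ 2 * (2 * ∑ i, u i ^ 2 + 8 / N * S ^ 2) := by
        rw [← Finset.mul_sum, Finset.sum_add_distrib, ← Finset.mul_sum, Finset.sum_const,
          Finset.card_univ, Fintype.card_fin, nsmul_eq_mul]
        congr 2
        field_simp
    _ ≤ M ^ 2 * (2 * ∑ i, u i ^ 2 + 8 / N * (N * ∑ i, u i ^ 2)) := by gcongr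
    _ = _ := by field_simp; ring

theorem erase_nonempty (hN : 2 ≤ N) (i : Fin N) : (Finset.univ.erase i).Nonempty := by
  rw [← Finset.card_pos, Finset.card_erase_of_mem (Finset.mem_univ i), Finset.card_univ,
    Fintype.card_fin]
  omega

theorem cast_card_erase (hN : 2 ≤ N) (i : Fin N) :
    ((Finset.univ.erase i).card : ℝ) = N - 1 := by
  rw [Finset.card_erase_of_mem (Finset.mem_univ i), Finset.card_univ, Fintype.card_fin,
    Nat.cast_sub (by omega), Nat.cast_one]

theorem average_erase_le (hN : 2 ≤ N) (i : Fin N) {u : Fin N → ℝ} (hu : ∀ j, 0 ≤ u j) :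
    ((N : ℝ) - 1)⁻¹ * ∑ j ∈ Finset.univ.erase i, u j ≤ 2 / N * ∑ j, u j := by
  have hN' : (2 : ℝ) ≤ N := by exact_mod_cast hN
  have h1 : ((N : ℝ) - 1)⁻¹ ≤ 2 / N := by
    rw [inv_eq_one_div, div_le_div_iff₀ (by linarith) (by linarith)]; linarith
  exact mul_le_mul h1 (Finset.sum_le_univ_sum_of_nonneg hu) (Finset.sum_nonneg fun j _ => hu j)
    (by positivity)

/-- The left-hand sides `D_a L(x^i, a^i, m^{N,-i})` of the first-order conditions of the players. -/
def playerField (L : Lagrangian d) (x a : Fin N → Rd d) : PiLp 2 fun _ : Fin N => Rd d :=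
  vec fun i => gradA L (x i) (a i) (empiricalWithout i x a)

/-- The vectors `D_a L(x^i, a^i, m^N)`, in which each player takes part in the mean field. -/
def meanField (L : Lagrangian d) (x a : Fin N → Rd d) : PiLp 2 fun _ : Fin N => Rd d :=
  vec fun i => gradA L (x i) (a i) (empiricalAll x a)

theorem isPlayerFixedPoint_iff (hL : Regular L) (x p a : Fin N → Rd d) :
    IsPlayerFixedPoint L x p a ↔ playerField L x a = -vec p := by
  simp only [IsPlayerFixedPoint, hL.eq_neg_gradPH_iff]
  exact ⟨fun h => congrArg vec (funext h), fun h i => congrFun (congrArg WithLp.ofLp h) i⟩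

theorem jointLaw_uniformSum (hN : 2 ≤ N) (x a : Fin N → Rd d)
    [IsProbabilityMeasure (uniformSum (Finset.univ : Finset (Fin N)) id)]
    (hx : MemLp x 2 (uniformSum (Finset.univ : Finset (Fin N)) id))
    (ha : MemLp a 2 (uniformSum (Finset.univ : Finset (Fin N)) id)) :
    jointLaw (uniformSum Finset.univ id) x a hx ha = empiricalAll x a :=
  P2.law_uniformSum _ ⟨⟨0, by omega⟩, Finset.mem_univ _⟩ _ _

theorem isProbabilityMeasure_uniformSum_univ (hN : 2 ≤ N) :
    IsProbabilityMeasure (uniformSum (Finset.univ : Finset (Fin N)) id) :=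
  isProbabilityMeasure_uniformSum ⟨⟨0, by omega⟩, Finset.mem_univ _⟩

theorem GradABounds.meanField_mono (h : GradABounds L c K) (hN : 2 ≤ N) (x a b : Fin N → Rd d) :
    c * ‖vec a - vec b‖ ^ 2 ≤ inner ℝ (meanField L x a - meanField L x b) (vec a - vec b) := by
  have := isProbabilityMeasure_uniformSum_univ hN
  have hN0 : (0 : ℝ) < (N : ℝ)⁻¹ := inv_pos.2 (by exact_mod_cast (by omega : 0 < N))
  have hm := h.mono (uniformSum (Finset.univ : Finset (Fin N)) id) (X := x) (α := a) (α' := b)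
    .of_discrete .of_discrete .of_discrete
  rw [jointLaw_uniformSum hN, jointLaw_uniformSum hN, integral_uniformSum, integral_uniformSum,
    Finset.card_univ, Fintype.card_fin, smul_eq_mul, smul_eq_mul, mul_left_comm] at hm
  rw [vec_sub_vec, norm_vec_sq, PiLp.inner_apply]
  exact le_of_mul_le_mul_left hm hN0

theorem d2_empiricalAll_sq_le (hN : 2 ≤ N) (x a b : Fin N → Rd d) :
    d2 (empiricalAll x a) (empiricalAll x b) ^ 2 ≤ (N : ℝ)⁻¹ * ‖vec a - vec b‖ ^ 2 := by
  have := isProbabilityMeasure_uniformSum_univ hN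
  have hd := d2_law_sq_le (uniformSum (Finset.univ : Finset (Fin N)) id)
    (Z := fun j => mk (x j) (a j)) (Z' := fun j => mk (x j) (b j)) .of_discrete .of_discrete
  rw [P2.law_uniformSum _ ⟨⟨0, by omega⟩, Finset.mem_univ _⟩,
    P2.law_uniformSum _ ⟨⟨0, by omega⟩, Finset.mem_univ _⟩, integral_uniformSum,
    Finset.card_univ, Fintype.card_fin, smul_eq_mul] at hd
  simp only [norm_mk_sub_mk_right, id] at hd
  rw [vec_sub_vec, norm_vec_sq]
  exact hd

/-- The effect of removing the own contribution of each player from the mean field is a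
perturbation that is Lipschitz continuous in the controls with a constant of order `1 / N`. -/
theorem GradABounds.norm_perturbation_sub_le (h : GradABounds L c K) (hN : 2 ≤ N)
    (x a b : Fin N → Rd d) :
    ‖(playerField L x a - meanField L x a) - (playerField L x b - meanField L x b)‖ ≤
      10 * K / N * ‖vec a - vec b‖ := by
  have hK0 := h.nonneg
  have hN' : (2 : ℝ) ≤ N := by exact_mod_cast hN
  obtain ⟨g, hg, hK⟩ := h.flat
  obtain ⟨u, hu⟩ : ∃ u : Fin N → ℝ, u = fun j => ‖a j - b j‖ := ⟨_, rfl⟩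
  have hu0 : ∀ j, 0 ≤ u j := fun j => by rw [hu]; exact norm_nonneg _
  obtain ⟨D, hD⟩ : ∃ D, D = 2 / N * ∑ j, u j := ⟨_, rfl⟩
  have hD0 : 0 ≤ D := hD ▸ mul_nonneg (by positivity) (Finset.sum_nonneg fun j _ => hu0 j)
  have key : ∀ i, ‖(gradA L (x i) (a i) (empiricalWithout i x a) -
      gradA L (x i) (a i) (empiricalAll x a)) - (gradA L (x i) (b i) (empiricalWithout i x b) -
      gradA L (x i) (b i) (empiricalAll x b))‖ ≤ 3 * K / N * (u i + D) := fun i => by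
    refine norm_sub_sub_sub_le_of_flatDeriv (hg (x i) (a i)) (hg (x i) (b i)) _ _ _ _ fun t => ?_
    unfold empiricalWithout empiricalAll
    rw [integral_empirical_erase_sub hN, integral_empirical_erase_sub hN, ← smul_sub,
      ← Finset.sum_sub_distrib, norm_smul, Real.norm_of_nonneg
        (inv_nonneg.2 (mul_nonneg (by linarith) (by linarith)))]
    have hd1 := d1_mix_empirical_le (s := (Finset.univ : Finset (Fin N)))
      (s' := Finset.univ.erase i) ⟨i, Finset.mem_univ i⟩ (erase_nonempty hN i)
      (fun j => mk (x j) (a j)) (fun j => mk (x j) (b j)) (B := D) (by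
        simp only [norm_mk_sub_mk_right, Finset.card_univ, Fintype.card_fin, hD, hu]
        refine mul_le_mul_of_nonneg_right ?_ (Finset.sum_nonneg fun j _ => norm_nonneg (a j - b j))
        rw [inv_eq_one_div]; gcongr; norm_num) (by
        simp only [norm_mk_sub_mk_right, cast_card_erase hN, hD]
        have := average_erase_le hN i hu0
        simpa only [hu] using this) t
    have hsum : ∀ m m', d1 m m' ≤ D → ‖∑ j ∈ Finset.univ.erase i,
        ((g (x i) (a i) m (mk (x j) (a j)) - g (x i) (a i) m (mk (x i) (a i))) -
          (g (x i) (b i) m' (mk (x j) (b j)) - g (x i) (b i) m' (mk (x i) (b i))))‖ ≤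
        K * (((N : ℝ) - 1) * (3 * u i + 2 * D) + ∑ j ∈ Finset.univ.erase i, u j) := by
      intro m m' hm
      have hterm : ∀ j, ‖g (x i) (a i) m (mk (x j) (a j)) - g (x i) (b i) m' (mk (x j) (b j))‖ ≤
          K * (u i + D + u j) := fun j => by
        refine (hK _ _ _ _ _ _ _ _).trans (mul_le_mul_of_nonneg_left ?_ hK0)
        rw [sub_self, norm_zero, zero_add, norm_mk_sub_mk_right, hu]
        exact add_le_add (add_le_add le_rfl hm) le_rfl
      refine (norm_sum_le_of_le _ (n := fun j => K * (3 * u i + 2 * D + u j)) fun j _ => ?_).trans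
        (le_of_eq ?_)
      · rw [sub_sub_sub_comm]
        refine (norm_sub_le _ _).trans ((add_le_add (hterm j) (hterm i)).trans (le_of_eq ?_))
        ring
      · rw [← Finset.mul_sum, Finset.sum_add_distrib, Finset.sum_const, nsmul_eq_mul,
          cast_card_erase hN]
    refine (mul_le_mul_of_nonneg_left (hsum _ _ hd1)
      (inv_nonneg.2 (mul_nonneg (by linarith) (by linarith)))).trans ?_
    have h1 : (0 : ℝ) < N - 1 := by linarith
    have h2 := average_erase_le hN i hu0
    rw [← hD] at h2
    calc _ = K / N * ((3 * u i + 2 * D) +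
          ((N : ℝ) - 1)⁻¹ * ∑ j ∈ Finset.univ.erase i, u j) := by
          have : (N : ℝ) ≠ 0 := by linarith
          field_simp
      _ ≤ K / N * ((3 * u i + 2 * D) + D) := by gcongr
      _ = _ := by ring
  have hv := norm_vec_sq_le_of_average hN (u := u) (M := 3 * K / N)
    (fun i => by rw [← hD]; exact key i)
  have hsq : ∑ i, u i ^ 2 = ‖vec a - vec b‖ ^ 2 := by rw [vec_sub_vec, norm_vec_sq, hu]; rfl
  rw [hsq] at hv
  refine abs_le_of_sq_le_sq' ?_ (by positivity) |>.2
  refine le_trans (le_of_eq ?_) (hv.trans ?_)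
  · rfl
  · have : 0 ≤ (K / N) ^ 2 * ‖vec a - vec b‖ ^ 2 := by positivity
    have e : (10 * K / N * ‖vec a - vec b‖) ^ 2 = 100 * ((K / N) ^ 2 * ‖vec a - vec b‖ ^ 2) := by
      ring
    have e' : 10 * (3 * K / N) ^ 2 * ‖vec a - vec b‖ ^ 2 =
        90 * ((K / N) ^ 2 * ‖vec a - vec b‖ ^ 2) := by ring
    rw [e, e']
    linarith

/-- For many players the first-order conditions are strongly monotone. -/
theorem GradABounds.playerField_mono (h : GradABounds L c K) (hN : 2 ≤ N) (hNK : 20 * K ≤ c * N)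
    (x a b : Fin N → Rd d) :
    c / 2 * ‖vec a - vec b‖ ^ 2 ≤
      inner ℝ (playerField L x a - playerField L x b) (vec a - vec b) := by
  have h1 := h.meanField_mono hN x a b
  have h2 := h.norm_perturbation_sub_le hN x a b
  have hN0 : (0 : ℝ) < N := by exact_mod_cast (by omega : 0 < N)
  have h3 : 10 * K / N ≤ c / 2 := by rw [div_le_iff₀ hN0]; linarith
  have e : playerField L x a - playerField L x b = (meanField L x a - meanField L x b) +
      ((playerField L x a - meanField L x a) - (playerField L x b - meanField L x b)) := by abel
  rw [e, inner_add_left]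
  have h4 := (abs_le.1 (abs_real_inner_le_norm ((playerField L x a - meanField L x a) -
    (playerField L x b - meanField L x b)) (vec a - vec b))).1
  have h5 := mul_le_mul_of_nonneg_right (h2.trans (mul_le_mul_of_nonneg_right h3 (norm_nonneg _)))
    (norm_nonneg (vec a - vec b))
  linarith [sq ‖vec a - vec b‖]

theorem GradABounds.playerField_lipschitz (h : GradABounds L c K) (hN : 2 ≤ N)
    (x a x' a' : Fin N → Rd d) :
    ‖playerField L x a - playerField L x' a'‖ ^ 2 ≤
      20 * K ^ 2 * (‖vec x - vec x'‖ ^ 2 + ‖vec a - vec a'‖ ^ 2) := by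
  have hK0 := h.nonneg
  have hv := norm_vec_sq_le_of_average hN (M := K) (u := fun j => ‖x j - x' j‖ + ‖a j - a' j‖)
    (f := fun i => gradA L (x i) (a i) (empiricalWithout i x a) -
      gradA L (x' i) (a' i) (empiricalWithout i x' a')) (fun i => by
    have := isProbabilityMeasure_uniformSum (z := (id : Fin N → Fin N)) (erase_nonempty hN i)
    have h1 := h.lip_law (uniformSum (Finset.univ.erase i) id) (Z := fun j => mk (x j) (a j))
      (Z' := fun j => mk (x' j) (a' j)) .of_discrete .of_discrete (x' i) (a' i)
    rw [P2.law_uniformSum _ (erase_nonempty hN i), P2.law_uniformSum _ (erase_nonempty hN i),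
      integral_uniformSum, cast_card_erase hN, smul_eq_mul] at h1
    have h2 : ((N : ℝ) - 1)⁻¹ * ∑ j ∈ Finset.univ.erase i, ‖mk (x j) (a j) - mk (x' j) (a' j)‖ ≤
        2 / N * ∑ j, (‖x j - x' j‖ + ‖a j - a' j‖) :=
      (average_erase_le hN i fun j => norm_nonneg _).trans (by
        gcongr with j
        exact norm_mk_le _ _)
    have h3 := h.lip (x i) (a i) (x' i) (a' i) (empiricalWithout i x a)
    refine (norm_sub_le_norm_sub_add_norm_sub _
      (gradA L (x' i) (a' i) (empiricalWithout i x a)) _).trans ?_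
    rw [mul_add]
    exact add_le_add h3 (h1.trans (mul_le_mul_of_nonneg_left h2 hK0)))
  refine le_trans (le_of_eq ?_) (hv.trans ?_)
  · rfl
  · rw [vec_sub_vec, vec_sub_vec, norm_vec_sq, norm_vec_sq, ← Finset.sum_add_distrib,
      Finset.mul_sum, Finset.mul_sum]
    refine Finset.sum_le_sum fun j _ => ?_
    simp only [Pi.sub_apply]
    nlinarith [mul_nonneg (sq_nonneg K) (sq_nonneg (‖x j - x' j‖ - ‖a j - a' j‖))]

/-- The perturbation itself is of order `1 / N`, relative to the distances of the points
`(x^j, a^j)` from an arbitrary common reference point. -/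
theorem GradABounds.norm_perturbation_sq_le (h : GradABounds L c K) (hN : 2 ≤ N)
    (x a : Fin N → Rd d) (a₀ : Rd d) :
    ‖playerField L x a - meanField L x a‖ ^ 2 ≤
      40 * K ^ 2 / N ^ 2 * ∑ j, (‖x j‖ ^ 2 + ‖a j - a₀‖ ^ 2) := by
  have hK0 := h.nonneg
  have hN' : (2 : ℝ) ≤ N := by exact_mod_cast hN
  obtain ⟨g, hg, hK⟩ := h.flat
  obtain ⟨w, hw⟩ : ∃ w : Fin N → ℝ, w = fun j => ‖mk (x j) (a j) - mk 0 a₀‖ := ⟨_, rfl⟩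
  have hw0 : ∀ j, 0 ≤ w j := fun j => by rw [hw]; exact norm_nonneg _
  have key : ∀ i, ‖gradA L (x i) (a i) (empiricalWithout i x a) -
      gradA L (x i) (a i) (empiricalAll x a)‖ ≤ K / N * (w i + 2 / N * ∑ j, w j) := fun i => by
    refine norm_sub_le_of_flatDeriv (hg (x i) (a i)) _ _ fun t => ?_
    have hterm : ∀ μ, ∀ j ∈ Finset.univ.erase i, ‖g (x i) (a i) μ (mk (x j) (a j)) -
        g (x i) (a i) μ (mk (x i) (a i))‖ ≤ K * (w i + w j) := fun μ j _ => by
      refine (hK _ _ _ _ _ _ _ _).trans (mul_le_mul_of_nonneg_left ?_ hK0)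
      rw [sub_self, norm_zero, sub_self, norm_zero, d1_self, zero_add, zero_add, zero_add, hw,
        add_comm]
      exact (norm_sub_le_norm_sub_add_norm_sub _ (mk 0 a₀) _).trans
        (add_le_add le_rfl (norm_sub_rev _ _).le)
    unfold empiricalWithout empiricalAll
    rw [integral_empirical_erase_sub hN, norm_smul, Real.norm_of_nonneg
        (inv_nonneg.2 (mul_nonneg (by linarith) (by linarith)))]
    refine (mul_le_mul_of_nonneg_left (norm_sum_le_of_le _ (hterm _))
      (inv_nonneg.2 (mul_nonneg (by linarith) (by linarith)))).trans ?_
    rw [← Finset.mul_sum, Finset.sum_add_distrib, Finset.sum_const, nsmul_eq_mul,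
      cast_card_erase hN]
    have h1 : (0 : ℝ) < N - 1 := by linarith
    calc _ = K / N * (w i + ((N : ℝ) - 1)⁻¹ * ∑ j ∈ Finset.univ.erase i, w j) := by
          have : (N : ℝ) ≠ 0 := by linarith
          field_simp
      _ ≤ _ := mul_le_mul_of_nonneg_left (add_le_add le_rfl (average_erase_le hN i hw0))
          (by positivity)
  have hv := norm_vec_sq_le_of_average hN (u := w) (M := K / N) key
  refine le_trans (le_of_eq ?_) (hv.trans ?_)
  · rfl
  · have hs : ∑ i, w i ^ 2 = ∑ j, (‖x j‖ ^ 2 + ‖a j - a₀‖ ^ 2) := by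
      simp only [hw, mk_sub_mk, norm_mk_sq, sub_zero]
    rw [hs, div_pow, mul_div_assoc]
    have : 0 ≤ K ^ 2 / N ^ 2 * ∑ j, (‖x j‖ ^ 2 + ‖a j - a₀‖ ^ 2) :=
      mul_nonneg (by positivity) (Finset.sum_nonneg fun j _ => by positivity)
    nlinarith

/-- Well-posedness of the `N`-player equations. -/
theorem GradABounds.existsUnique_playerFixedPoint (h : GradABounds L c K) (hL : Regular L)
    (hN : 2 ≤ N) (hNK : 20 * K ≤ c * N) (x p : Fin N → Rd d) :
    ∃! a, IsPlayerFixedPoint L x p a := by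
  have hc := h.pos
  have hK := h.nonneg
  obtain ⟨v, hv⟩ := exists_eq_of_stronglyMonotone (F := fun v => playerField L x v.ofLp)
    (half_pos hc) (fun u v => h.playerField_mono hN hNK x u.ofLp v.ofLp) (K := 5 * K)
    (fun u v => by
      refine abs_le_of_sq_le_sq' ?_ (by positivity) |>.2
      have := h.playerField_lipschitz hN x u.ofLp x v.ofLp
      rw [sub_self, norm_zero] at this
      change _ ≤ 20 * K ^ 2 * (0 ^ 2 + ‖u - v‖ ^ 2) at this
      nlinarith [mul_nonneg (sq_nonneg K) (sq_nonneg ‖u - v‖)]) (-vec p)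
  refine ⟨v.ofLp, (isPlayerFixedPoint_iff hL x p _).2 hv, fun b hb => ?_⟩
  replace hb := (isPlayerFixedPoint_iff hL x p b).1 hb
  have h1 := mul_norm_le_of_mul_sq_le_inner (h.playerField_mono hN hNK x b v.ofLp)
  rw [hb, show playerField L x v.ofLp = -vec p from hv, sub_self, norm_zero] at h1
  have h2 : ‖vec b - vec v.ofLp‖ ≤ 0 := nonpos_of_mul_nonpos_right h1 (half_pos hc)
  rw [norm_le_zero_iff, sub_eq_zero] at h2
  exact congrArg WithLp.ofLp h2

theorem GradABounds.playerFixedPoint_lipschitz (h : GradABounds L c K) (hL : Regular L)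
    (hN : 2 ≤ N) (hNK : 20 * K ≤ c * N) {x p a x' p' a' : Fin N → Rd d}
    (ha : IsPlayerFixedPoint L x p a) (ha' : IsPlayerFixedPoint L x' p' a') :
    ‖vec a - vec a'‖ ^ 2 ≤ (8 + 160 * K ^ 2) / c ^ 2 *
      ∑ i, (‖x i - x' i‖ ^ 2 + ‖p i - p' i‖ ^ 2) := by
  have hc := h.pos
  rw [isPlayerFixedPoint_iff hL] at ha ha'
  have h1 := mul_norm_le_of_mul_sq_le_inner (h.playerField_mono hN hNK x a a')
  have h2 := h.playerField_lipschitz hN x a' x' a'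
  rw [sub_self (vec a'), norm_zero] at h2
  have e : playerField L x a - playerField L x a' =
      -(vec p - vec p') - (playerField L x a' - playerField L x' a') := by
    rw [ha, ha']; abel
  rw [e] at h1
  have h3 := h1.trans (norm_sub_le _ _)
  rw [norm_neg] at h3
  have h4 := pow_le_pow_left₀ (by positivity) h3 2
  rw [Finset.sum_add_distrib, div_mul_eq_mul_div, le_div_iff₀ (by positivity)]
  have e1 : ∑ i, ‖x i - x' i‖ ^ 2 = ‖vec x - vec x'‖ ^ 2 := by rw [vec_sub_vec, norm_vec_sq]; rfl
  have e2 : ∑ i, ‖p i - p' i‖ ^ 2 = ‖vec p - vec p'‖ ^ 2 := by rw [vec_sub_vec, norm_vec_sq]; rfl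
  rw [e1, e2]
  nlinarith [sq_nonneg (‖vec p - vec p'‖ - ‖playerField L x a' - playerField L x' a'‖),
    sq_nonneg ‖vec x - vec x'‖, mul_nonneg (sq_nonneg K) (sq_nonneg ‖vec p - vec p'‖)]

end Players

/-! ### Comparison of the `N`-player equations with the mean field equation -/

section Comparison

variable {d : ℕ} {L : Lagrangian d} {c K : ℝ} {N : ℕ}

/-- For empirical data the solution of the mean field equation is itself empirical. -/
theorem IsMeanFieldFixedPoint.empiricalAll_eq (hL : Regular L) (hN : 2 ≤ N) {x p : Fin N → Rd d}
    {μ : P2 (RdRd d)} (hμ : IsMeanFieldFixedPoint L (empiricalAll x p) μ) :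
    empiricalAll x (fun i => -gradPH L (x i) (p i) μ) = μ := by
  have := isProbabilityMeasure_uniformSum_univ hN
  have h := hμ.jointLaw_eq hL (P := uniformSum (Finset.univ : Finset (Fin N)) id)
    .of_discrete .of_discrete (jointLaw_uniformSum hN x p _ _)
  rwa [jointLaw_uniformSum hN] at h

theorem IsMeanFieldFixedPoint.meanField_eq (hL : Regular L) (hN : 2 ≤ N) {x p : Fin N → Rd d}
    {μ : P2 (RdRd d)} (hμ : IsMeanFieldFixedPoint L (empiricalAll x p) μ) :
    meanField L x (fun i => -gradPH L (x i) (p i) μ) = -vec p := by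
  rw [meanField, hμ.empiricalAll_eq hL hN]
  exact congrArg vec (funext fun i => (hL.eq_neg_gradPH_iff _ _ _ _).1 rfl)

theorem P2.empirical_const {W ι : Type*} [NormedAddCommGroup W] [MeasurableSpace W]
    [MeasurableSingletonClass W] {s : Finset ι} (hs : s.Nonempty) (w : W) :
    P2.empirical s (fun _ => w) = P2.dirac w := by
  refine P2.ext ?_
  have h0 : (s.card : ℝ≥0∞) ≠ 0 := by simpa using hs.ne_empty
  rw [P2.toMeasure_empirical hs, uniformSum, Finset.sum_const, ← Nat.cast_smul_eq_nsmul ℝ≥0∞,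
    smul_smul, ENNReal.inv_mul_cancel h0 (ENNReal.natCast_ne_top _), one_smul]
  rfl

/-- For vanishing data the mean field equation and the `N`-player equations have the same constant
solution, since removing one of several equal points does not change their empirical measure. -/
theorem GradABounds.exists_const_isPlayerFixedPoint (h : GradABounds L c K) (hL : Regular L)
    (hN : 2 ≤ N) : ∃ a₀ : Rd d, IsPlayerFixedPoint L (0 : Fin N → Rd d) 0 fun _ => a₀ := by
  obtain ⟨μ, hμ⟩ := exists_isMeanFieldFixedPoint hL h (empiricalAll (0 : Fin N → Rd d) 0)
  refine ⟨-gradPH L 0 0 μ, fun i => ?_⟩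
  have e : empiricalWithout i (0 : Fin N → Rd d) (fun _ => -gradPH L 0 0 μ) = μ := by
    refine Eq.trans ?_ (hμ.empiricalAll_eq hL hN)
    simp only [empiricalWithout, empiricalAll, Pi.zero_apply]
    rw [P2.empirical_const (erase_nonempty hN i), P2.empirical_const ⟨i, Finset.mem_univ i⟩]
  rw [e]
  rfl

/-- The propagation-of-chaos estimate: the empirical measure of the solution of the `N`-player
equations is close to the solution of the mean field equation. -/
theorem GradABounds.d2_sq_le (h : GradABounds L c K) (hL : Regular L) (hN : 2 ≤ N)
    (hNK : 20 * K ≤ c * N) {x p a : Fin N → Rd d} (ha : IsPlayerFixedPoint L x p a)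
    {μ : P2 (RdRd d)} (hμ : IsMeanFieldFixedPoint L (empiricalAll x p) μ) :
    d2 μ (empiricalAll x a) ^ 2 ≤ 40 * K ^ 2 / c ^ 2 * (1 + (8 + 160 * K ^ 2) / c ^ 2) / N ^ 2 *
      ∑ i, (‖x i‖ ^ 2 + ‖p i‖ ^ 2) := by
  have hc := h.pos
  have hN1 : (1 : ℝ) ≤ N := by exact_mod_cast (by omega : 1 ≤ N)
  obtain ⟨b, hb⟩ : ∃ b : Fin N → Rd d, b = fun i => -gradPH L (x i) (p i) μ := ⟨_, rfl⟩
  have hbμ : empiricalAll x b = μ := hb ▸ hμ.empiricalAll_eq hL hN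
  have hbp : meanField L x b = -vec p := hb ▸ hμ.meanField_eq hL hN
  obtain ⟨a₀, ha₀⟩ := h.exists_const_isPlayerFixedPoint hL hN
  obtain ⟨S, hS⟩ : ∃ S, S = ∑ i, (‖x i‖ ^ 2 + ‖p i‖ ^ 2) := ⟨_, rfl⟩
  obtain ⟨C, hC⟩ : ∃ C, C = (8 + 160 * K ^ 2) / c ^ 2 := ⟨_, rfl⟩
  rw [← hS, ← hC]
  have hS0 : 0 ≤ S := hS ▸ Finset.sum_nonneg fun i _ => by positivity
  have hC0 : 0 ≤ C := by rw [hC]; positivity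
  -- both `a` and `b` solve their first-order conditions with the same right-hand side `-p`
  have h1 := mul_norm_le_of_mul_sq_le_inner (h.meanField_mono hN x b a)
  rw [hbp, ← (isPlayerFixedPoint_iff hL x p a).1 ha] at h1
  have h2 := h.norm_perturbation_sq_le hN x a a₀
  have h3 : ∑ j, (‖x j‖ ^ 2 + ‖a j - a₀‖ ^ 2) ≤ (1 + C) * S := by
    have h4 := h.playerFixedPoint_lipschitz hL hN hNK ha ha₀
    simp only [Pi.zero_apply, sub_zero, ← hS, ← hC] at h4
    rw [vec_sub_vec, norm_vec_sq] at h4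
    have h5 : ∑ j, ‖x j‖ ^ 2 ≤ S := by
      rw [hS]
      exact Finset.sum_le_sum fun j _ => le_add_of_nonneg_right (by positivity)
    rw [Finset.sum_add_distrib, add_mul, one_mul]
    exact add_le_add h5 h4
  have h6 : c ^ 2 * ‖vec b - vec a‖ ^ 2 ≤ 40 * K ^ 2 / N ^ 2 * ((1 + C) * S) := by
    rw [← mul_pow]
    exact (pow_le_pow_left₀ (by positivity) h1 2).trans (h2.trans (by gcongr))
  rw [← le_div_iff₀' (by positivity)] at h6
  rw [← hbμ]
  calc d2 (empiricalAll x b) (empiricalAll x a) ^ 2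
      ≤ (N : ℝ)⁻¹ * ‖vec b - vec a‖ ^ 2 := d2_empiricalAll_sq_le hN x b a
    _ ≤ 1 * ‖vec b - vec a‖ ^ 2 := by gcongr; exact inv_le_one_of_one_le₀ hN1
    _ ≤ 40 * K ^ 2 / N ^ 2 * ((1 + C) * S) / c ^ 2 := by rw [one_mul]; exact h6
    _ = _ := by field_simp

end Comparison

end MFGC

theorem proposition1p1 {d : ℕ} (L : MFGC.Lagrangian d) (hL : MFGC.Regular L)
    (hmono : MFGC.WeaklyDisplacementMonotone L) :
    ∃ Φ : MFGC.P2 (MFGC.RdRd d) → MFGC.P2 (MFGC.RdRd d),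
      (∀ ν μ, MFGC.IsMeanFieldFixedPoint L ν μ ↔ μ = Φ ν) ∧
      (∃ C : ℝ, ∀ ν₁ ν₂, MFGC.d2 (Φ ν₁) (Φ ν₂) ≤ C * MFGC.d2 ν₁ ν₂) ∧
      ∃ (C : ℝ) (N₀ : ℕ), 2 ≤ N₀ ∧ ∀ N ≥ N₀,
        ∃ a : (Fin N → MFGC.Rd d) → (Fin N → MFGC.Rd d) → (Fin N → MFGC.Rd d),
          (∀ x p b, MFGC.IsPlayerFixedPoint L x p b ↔ b = a x p) ∧
          (∀ x p x' p', ∑ i, ‖a x p i - a x' p' i‖ ^ 2 ≤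
            C * ∑ i, (‖x i - x' i‖ ^ 2 + ‖p i - p' i‖ ^ 2)) ∧
          ∀ x p, MFGC.d2 (Φ (MFGC.empiricalAll x p)) (MFGC.empiricalAll x (a x p)) ^ 2 ≤
            C / (N : ℝ) ^ 2 * ∑ i, (‖x i‖ ^ 2 + ‖p i‖ ^ 2) := by
  obtain ⟨c, K, h⟩ := MFGC.exists_gradABounds hL hmono
  have hc := h.pos
  choose Φ hΦ using MFGC.exists_isMeanFieldFixedPoint hL h
  refine ⟨Φ, fun ν μ => ⟨fun hμ => hμ.unique hL h (hΦ ν), fun e => e ▸ hΦ ν⟩,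
    ⟨_, fun ν₁ ν₂ => (hΦ ν₁).d2_le hL h (hΦ ν₂)⟩, ?_⟩
  have hA : 0 ≤ (8 + 160 * K ^ 2) / c ^ 2 := by positivity
  have hB : 0 ≤ 40 * K ^ 2 / c ^ 2 * (1 + (8 + 160 * K ^ 2) / c ^ 2) := by positivity
  -- `N ≥ 20 K / c` keeps the `O(1/N)` perturbation below half of the monotonicity constant.
  refine ⟨(8 + 160 * K ^ 2) / c ^ 2 + 40 * K ^ 2 / c ^ 2 * (1 + (8 + 160 * K ^ 2) / c ^ 2),
    max 2 ⌈20 * K / c⌉₊, le_max_left _ _, fun N hN => ?_⟩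
  have hN2 : 2 ≤ N := (le_max_left _ _).trans hN
  have hNK : 20 * K ≤ c * N := by
    rw [← div_le_iff₀' hc]
    exact (Nat.le_ceil _).trans (by exact_mod_cast (le_max_right _ _).trans hN)
  choose a ha hau using h.existsUnique_playerFixedPoint hL hN2 hNK
  refine ⟨a, fun x p b => ⟨hau x p b, fun e => e ▸ ha x p⟩, fun x p x' p' => ?_, fun x p => ?_⟩
  · have h1 := h.playerFixedPoint_lipschitz hL hN2 hNK (ha x p) (ha x' p')
    rw [MFGC.vec_sub_vec, MFGC.norm_vec_sq] at h1
    refine h1.trans (mul_le_mul_of_nonneg_right (le_add_of_nonneg_right hB) ?_)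
    exact Finset.sum_nonneg fun i _ => by positivity
  · refine (h.d2_sq_le hL hN2 hNK (ha x p) (hΦ _)).trans ?_
    refine mul_le_mul_of_nonneg_right ?_ (Finset.sum_nonneg fun i _ => by positivity)
    exact div_le_div_of_nonneg_right (le_add_of_nonneg_left hA) (by positivity)
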